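/- Work over $\mathbb{C}(q)$. For $n\ge 1$ put $i'=2n+1-i$ for $1\le i\le 2n$, $\xi=-q^{-2n}$, $(\bar 1,\dots,\overline{2n})=(n-1,n-2,\dots,0,0,\dots,-n+1)$, let $e_{ij}$ be the matrix units of $\mathrm{End}\,\mathbb{C}^{2n}$, and set $$ \begin{aligned} \overline R^{[n]}(u)={}&\sum_{i}e_{ii}\otimes e_{ii}+\frac{u-1}{qu-q^{-1}}\sum_{i\ne j,j'}e_{ii}\otimes e_{jj} +\frac{q-q^{-1}}{qu-q^{-1}}\sum_{i>j,\,i\ne j'}e_{ij}\otimes e_{ji}\\ &+\frac{(q-q^{-1})u}{qu-q^{-1}}\sum_{i<j,\,i\ne j'}e_{ij}\otimes e_{ji} +\frac{1}{(u-q^{-2})(u-\xi)}\sum_{i,j}a_{ij}(u)\,e_{i'j'}\otimes e_{ij}, \end{aligned} $$ where $a_{ii}(u)=(q^{-2}u-\xi)(u-1)$, $a_{ij}(u)=(q^{-2}-1)\big(q^{\bar i-\bar j}\xi(u-1)-\delta_{ij'}(u-\xi)\big)$ for $i<j$, and $a_{ij}(u)=(q^{-2}-1)u\big(q^{\bar i-\bar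 j}(u-1)-\delta_{ij'}(u-\xi)\big)$ for $i>j$; its entries are expanded as power series in $u$. Let $U(\overline R^{[n]})$ be the unital associative $\mathbb{C}(q)$-algebra generated by an invertible central element $q^{c/2}$ and elements $\ell^{\pm}_{ij}[\mp m]$ ($1\le i,j\le 2n$, $m\ge 0$) with the defining relations $\ell^+_{ij}[0]=\ell^-_{ji}[0]=0$ for $i<j$; $\ell^+_{nn}[0]\,\ell^+_{n+1,n+1}[0]=1$; $\ell^+_{ii}[0]\,\ell^-_{ii}[0]=\ell^-_{ii}[0]\,\ell^+_{ii}[0]=1$; and $$\overline R(u/v)\mathcal L^{\pm}_1(u)\mathcal L^{\pm}_2(v)=\mathcal L^{\pm}_2(v)\mathcal L^{\pm}_1(u)\overline R(u/v),$$ $$\overline R(uq^{c}/v)\mathcal L^{+}_1(u)\mathcal L^{-}_2(v)=\mathcal L^{-}_2(v)\mathcal L^{+}_1(u)\overline R(uq^{-c}/v),$$ where $\overline R=\overline R^{[n]}$, $\ell^{\pm}_{ij}(u)=\sum_{m\ge 0}\ell^{\pm}_{ij}[\mp m]u^{\pm m}$, $\mathcal L^{\pm}_1(u)=\sum_{i,j}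 e_{ij}\otimes 1\otimes \ell^{\pm}_{ij}(u)$ and $\mathcal L^{\pm}_2(u)=\sum_{i,j} 1\otimes e_{ij}\otimes \ell^{\pm}_{ij}(u)$. Let $n\ge 2$ and $i'=2n+1-i$, and label the generators of $U(\overline R^{[n-1]})$ by the indices $2\le i,j\le 2'$ instead of $1,\dots,2n-2$. Then the series $\ell^{\pm}_{11}(u)$ over $U(\overline R^{[n]})$ are invertible, and the assignments $q^{\pm c/2}\mapsto q^{\pm c/2}$ and $$\ell^{\pm}_{ij}(u)\mapsto \left|\begin{matrix}\ell^{\pm}_{11}(u)&\ell^{\pm}_{1j}(u)\\ \ell^{\pm}_{i1}(u)&\boxed{\ell^{\pm}_{ij}(u)}\end{matrix}\right| =\ell^{\pm}_{ij}(u)-\ell^{\pm}_{i1}(u)\,\ell^{\pm}_{11}(u)^{-1}\,\ell^{\pm}_{1j}(u),\qquad 2\le i,j\le 2',$$ define a (unique) homomorphism of $\mathbb{C}(q)$-algebras $U(\overline R^{[n-1]})\to U(\overline R^{[n]})$. -/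

import Mathlib

open scoped Kronecker PowerSeries

noncomputable section

namespace TwistedRTT

/-! Indices `1, …, 2n` are modelled by `Fin (2 * n)`, that is by `0, …, 2n - 1`; the involution
`i ↦ i' = 2n + 1 - i` is then `Fin.rev`. -/

/-- The sequence `(n-1, n-2, …, 0, 0, …, -n+1)`. -/
def bar (n : ℕ) (i : Fin (2 * n)) : ℤ :=
  if (i : ℕ) < n then (n : ℤ) - 1 - i else (n : ℤ) - i

section RMatrix

variable {K : Type*} [Field K] (q : K) (n : ℕ)

/-- `ξ = -q^{-2n}`. -/
def xi : K := -(q ^ (2 * n))⁻¹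

/-- The polynomials `a_{ij}(u)`, as power series in `u`. -/
def aCoef (i j : Fin (2 * n)) : K⟦X⟧ :=
  let u : K⟦X⟧ := PowerSeries.X
  let ξ : K⟦X⟧ := PowerSeries.C (xi q n)
  let c : K⟦X⟧ := PowerSeries.C ((q ^ 2)⁻¹ - 1)
  let b : K⟦X⟧ := PowerSeries.C (q ^ (bar n i - bar n j))
  let δ : K⟦X⟧ := if i = j.rev then 1 else 0
  if i = j then (PowerSeries.C (q ^ 2)⁻¹ * u - ξ) * (u - 1)
  else if i < j then c * (b * ξ * (u - 1) - δ * (u - ξ))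
  else c * u * (b * (u - 1) - δ * (u - ξ))

/-- The matrix unit `e_{ij}`. -/
def e {n : ℕ} (i j : Fin (2 * n)) : Matrix (Fin (2 * n)) (Fin (2 * n)) (K⟦X⟧) :=
  Matrix.single i j 1

/-- The `R`-matrix `R̄(u)`, whose entries are rational functions of `u` without pole at `u = 0`,
expanded as power series in `u`. All inverses below are genuine when `q ≠ 0`, because the
series inverted have constant terms `-q⁻¹` and `q⁻² ξ`. The coefficient of `e_{ij} ⊗ e_{kl}` is
the entry at `(i, k), (j, l)`. -/
def Rbar : Matrix (Fin (2 * n) × Fin (2 * n)) (Fin (2 * n) × Fin (2 * n)) (K⟦X⟧) :=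
  let u : K⟦X⟧ := PowerSeries.X
  let d : K⟦X⟧ := (PowerSeries.C q * u - PowerSeries.C q⁻¹)⁻¹
  let c : K⟦X⟧ := PowerSeries.C (q - q⁻¹)
  (∑ i, e i i ⊗ₖ e i i)
  + ((u - 1) * d) • (∑ i, ∑ j, if i ≠ j ∧ i ≠ j.rev then e i i ⊗ₖ e j j else 0)
  + (c * d) • (∑ i, ∑ j, if j < i ∧ i ≠ j.rev then e i j ⊗ₖ e j i else 0)
  + (c * u * d) • (∑ i, ∑ j, if i < j ∧ i ≠ j.rev then e i j ⊗ₖ e j i else 0)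
  + ((u - PowerSeries.C (q ^ 2)⁻¹) * (u - PowerSeries.C (xi q n)))⁻¹ •
      (∑ i, ∑ j, aCoef q n i j • (e i.rev j.rev ⊗ₖ e i j))

end RMatrix

/-- The coefficients (at `u ^ m`, `m : ℤ`) of the formal series `∑_k s_k u^k` (for `ε = true`,
the sign `+`) or `∑_k s_k u^{-k}` (for `ε = false`, the sign `-`). -/
def seriesCoeff {A : Type*} [Zero A] (ε : Bool) (s : ℕ → A) (m : ℤ) : A :=
  match ε with
  | true => if 0 ≤ m then s m.toNat else 0
  | false => if m ≤ 0 then s (-m).toNat else 0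

section RTT

variable {K : Type*} [Field K] (q : K) (n : ℕ) {A : Type*} [Ring A] [Algebra K A]

/-- The coefficient at `u^a v^b ⊗ e_{ij} ⊗ e_{kl}` of `R̄(w u / v) L₁(u) M₂(v)`, where
`L_{ij}(u) = ∑_m L i j m u^m` and `M_{ij}(v) = ∑_m M i j m v^m`. The summation index `t` is the
power of `u / v` coming from `R̄`. Whenever it is used below, `L` has only nonnegative
powers or `M` has only nonpositive powers, so that every term beyond the range of `t` vanishes. -/
def rttLeft (w : A) (L M : Fin (2 * n) → Fin (2 * n) → ℤ → A) (i j k l : Fin (2 * n))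
    (a b : ℤ) : A :=
  ∑ t ∈ Finset.range (a.natAbs + b.natAbs + 1), ∑ p, ∑ r,
    PowerSeries.coeff t (Rbar q n (i, k) (p, r)) • (w ^ t * L p j (a - t) * M r l (b + t))

/-- The coefficient at `u^a v^b ⊗ e_{ij} ⊗ e_{kl}` of `M₂(v) L₁(u) R̄(w u / v)`. -/
def rttRight (w : A) (L M : Fin (2 * n) → Fin (2 * n) → ℤ → A) (i j k l : Fin (2 * n))
    (a b : ℤ) : A :=
  ∑ t ∈ Finset.range (a.natAbs + b.natAbs + 1), ∑ p, ∑ r,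
    PowerSeries.coeff t (Rbar q n (p, r) (j, l)) • (M k r (b + t) * L i p (a - t) * w ^ t)

end RTT

/-- Generators: `q^{c/2}`, `q^{-c/2}`, and `ℓ^±_{ij}[∓m]` (`ell true i j m` is `ℓ⁺_{ij}[-m]`,
`ell false i j m` is `ℓ⁻_{ij}[m]`). -/
inductive Gen (n : ℕ) : Type
  | qc : Gen n
  | qcInv : Gen n
  | ell (ε : Bool) (i j : Fin (2 * n)) (m : ℕ) : Gen n

section Algebra

variable {K : Type*} [Field K] (q : K) (n : ℕ)

/-- The generators as elements of the free algebra. -/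
abbrev fr (K : Type*) [Field K] {n : ℕ} (x : Gen n) : FreeAlgebra K (Gen n) := FreeAlgebra.ι K x

/-- The coefficients of the series `ℓ^±_{ij}(u) = ∑_{m ≥ 0} ℓ^±_{ij}[∓m] u^{±m}` in the free
algebra. -/
def frL (K : Type*) [Field K] {n : ℕ} (ε : Bool) (i j : Fin (2 * n)) (m : ℤ) :
    FreeAlgebra K (Gen n) :=
  seriesCoeff ε (fun k => fr K (Gen.ell ε i j k)) m

/-- The defining relations of the algebra `U(R̄)` of rank `n`. -/
inductive Rel : FreeAlgebra K (Gen n) → FreeAlgebra K (Gen n) → Prop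
  | qc_mul_inv : Rel (fr K Gen.qc * fr K Gen.qcInv) 1
  | qc_inv_mul : Rel (fr K Gen.qcInv * fr K Gen.qc) 1
  | qc_central (x : Gen n) : Rel (fr K Gen.qc * fr K x) (fr K x * fr K Gen.qc)
  | plus_upper (i j : Fin (2 * n)) (h : i < j) : Rel (fr K (Gen.ell true i j 0)) 0
  | minus_lower (i j : Fin (2 * n)) (h : i < j) : Rel (fr K (Gen.ell false j i 0)) 0
  -- `i` and `j` are the two middle indices, called `n` and `n + 1` when counting from `1`
  | middle (i j : Fin (2 * n)) (hi : (i : ℕ) + 1 = n) (hj : (j : ℕ) = n) :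
      Rel (fr K (Gen.ell true i i 0) * fr K (Gen.ell true j j 0)) 1
  | plus_minus (i : Fin (2 * n)) :
      Rel (fr K (Gen.ell true i i 0) * fr K (Gen.ell false i i 0)) 1
  | minus_plus (i : Fin (2 * n)) :
      Rel (fr K (Gen.ell false i i 0) * fr K (Gen.ell true i i 0)) 1
  -- `R̄(u/v) L^±₁(u) L^±₂(v) = L^±₂(v) L^±₁(u) R̄(u/v)`
  | rtt_same (ε : Bool) (i j k l : Fin (2 * n)) (a b : ℤ) :
      Rel (rttLeft q n 1 (frL K ε) (frL K ε) i j k l a b)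
        (rttRight q n 1 (frL K ε) (frL K ε) i j k l a b)
  -- `R̄(u q^c / v) L⁺₁(u) L⁻₂(v) = L⁻₂(v) L⁺₁(u) R̄(u q^{-c} / v)`
  | rtt_mixed (i j k l : Fin (2 * n)) (a b : ℤ) :
      Rel (rttLeft q n (fr K Gen.qc ^ 2) (frL K true) (frL K false) i j k l a b)
        (rttRight q n (fr K Gen.qcInv ^ 2) (frL K true) (frL K false) i j k l a b)

/-- The algebra `U(R̄)` of rank `n` over `K` with parameter `q`. -/
def U : Type _ := RingQuot (Rel q n)

instance : Ring (U q n) :=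
  @RingQuot.instRing (FreeAlgebra K (Gen n)) inferInstance (Rel q n)

instance : Algebra K (U q n) :=
  inferInstanceAs (Algebra K (RingQuot (Rel q n)))

/-- The image of a generator in `U(R̄)`. -/
def gen (x : Gen n) : U q n := RingQuot.mkAlgHom K (Rel q n) (fr K x)

/-- The series `ℓ^±_{ij}(u)`, as a power series in the variable `u` for the sign `+`
(`ε = true`) and in the variable `u⁻¹` for the sign `-` (`ε = false`). -/
def ellSeries (ε : Bool) (i j : Fin (2 * n)) : (U q n)⟦X⟧ :=
  PowerSeries.mk fun m => gen q n (Gen.ell ε i j m)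

end Algebra

/-- The quasideterminant `a₂₂ - a₂₁ a₁₁⁻¹ a₁₂` of a `2 × 2` matrix with the entry `a₂₂` boxed
(meaningful when `a₁₁` is invertible). -/
def quasiDet {S : Type*} [Ring S] (a : Matrix (Fin 2) (Fin 2) S) : S :=
  a 1 1 - a 1 0 * Ring.inverse (a 0 0) * a 0 1

/-- The first index of rank `n + 1`. -/
def first (n : ℕ) : Fin (2 * (n + 1)) := ⟨0, by omega⟩

/-- The indices `2, …, 2'` of rank `n + 1` (counting from `1`), as the index set of rank `n`. -/
def shift {n : ℕ} (i : Fin (2 * n)) : Fin (2 * (n + 1)) := ⟨i + 1, by omega⟩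

end TwistedRTT

end

/-! Each exchange relation has the form `R L₁ M₂ = M₂ L₁ T` with central entries in `R` and `T`, and
the quasideterminants are the entries of the Schur complement of the corner `L₁₁`. The theorem holds
because passing to Schur complements of `L` and `M` is matched by Gaussian elimination in `R` and
`T`.

For the R-matrix, the column `(1, 1')` is cleared with the pivot at `(1, 1'), (1, 1')`. Only the
terms `e_{i'j'} ⊗ e_{ij}` are affected, and on the intermediate indices the result is exactly the
R-matrix of rank one less (`aCoef_elim`, `reduces_Rbar`). The column `(1', 1)` is not cleared, but
it only multiplies terms containing an entry in the first row or column of the Schur complement `N`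
of `M`, and these vanish.

For the factors, `exchange_schur_right` replaces `M` by `N`. The rows `(1, k)` of the new relation
show that `L₁₁` and `N` commute up to a central unit, and this allows `L` to be replaced by its
Schur complement too (`exchange_schur`). `R` and `T` are kept independent because the mixed relation
involves both `R(u q^c / v)` and `R(u q^{-c} / v)`.

For each of the three sign patterns, a change of variables places `r(u / v)`, `l(u)` and `m(v)` in
one ring `B⟦x⟧⟦y⟧` (`Expansion`), where the coefficientwise relations become an exchange relation
over central weights (`rtt_iff`). The triangularity and diagonal relations concern zero modes, where
triangularity removes the quasideterminant correction (`coeff_zero_serSchur`). -/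

noncomputable section

namespace TwistedRTT

/-! ### Weighted sums -/

section WeightedSum

variable {C A κ ι : Type*} [CommRing C] [Ring A] [Algebra C A] [Fintype κ] [Fintype ι]

/-- The sum `∑ c x • f x` with central weights `c x`. -/
def wsum (c : κ → C) (f : κ → A) : A := ∑ x, c x • f x

lemma wsum_sub (c : κ → C) (f g : κ → A) :
    wsum c (fun x => f x - g x) = wsum c f - wsum c g := by
  simp [wsum, smul_sub]

lemma wsum_add (c : κ → C) (f g : κ → A) :
    wsum c (fun x => f x + g x) = wsum c f + wsum c g := by
  simp [wsum, Finset.sum_add_distrib]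

lemma wsum_smul (c : κ → C) (a : C) (f : κ → A) :
    wsum c (fun x => a • f x) = a • wsum c f := by
  simp only [wsum, Finset.smul_sum]
  exact Finset.sum_congr rfl fun x _ => smul_comm _ _ _

lemma wsum_mul (c : κ → C) (f : κ → A) (y : A) :
    wsum c (fun x => f x * y) = wsum c f * y := by
  simp [wsum, Finset.sum_mul]

lemma wsum_mul_left (c : κ → C) (f : κ → A) (y : A) :
    wsum c (fun x => y * f x) = y * wsum c f := by
  simp [wsum, Finset.mul_sum]

lemma wsum_sub_weight (c d : κ → C) (a : C) (f : κ → A) :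
    wsum (fun x => c x - a * d x) f = wsum c f - a • wsum d f := by
  simp [wsum, sub_smul, Finset.smul_sum, mul_smul]

lemma wsum_comm (c : κ → C) (d : ι → C) (f : κ → ι → A) :
    wsum c (fun x => wsum d (f x)) = wsum d (fun y => wsum c (fun x => f x y)) := by
  simp only [wsum, Finset.smul_sum]
  rw [Finset.sum_comm]
  exact Finset.sum_congr rfl fun x _ => Finset.sum_congr rfl fun y _ => smul_comm _ _ _

lemma wsum_zero (c : κ → C) : wsum c (fun _ => (0 : A)) = 0 := by
  simp [wsum]

end WeightedSum

/-! ### The first, the last and the intermediate indices -/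

/-- The last index of rank `n + 1`. -/
def last (n : ℕ) : Fin (2 * (n + 1)) := ⟨2 * n + 1, by omega⟩

section Index

variable {n : ℕ}

@[simp] lemma rev_first : (first n).rev = last n := by
  ext; simp [first, last]

@[simp] lemma rev_last : (last n).rev = first n := by
  ext; simp [first, last, Fin.val_rev]; omega

@[simp] lemma rev_shift (i : Fin (2 * n)) : (shift i).rev = shift i.rev := by
  ext; simp [shift, Fin.val_rev]; omega

@[simp] lemma first_ne_last : first n ≠ last n := by
  simp [first, last]

@[simp] lemma last_ne_first : last n ≠ first n := first_ne_last.symm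

@[simp] lemma first_ne_shift (i : Fin (2 * n)) : first n ≠ shift i := by
  simp [first, shift]

@[simp] lemma shift_ne_first (i : Fin (2 * n)) : shift i ≠ first n := (first_ne_shift i).symm

@[simp] lemma last_ne_shift (i : Fin (2 * n)) : last n ≠ shift i := by
  simp [last, shift, Fin.ext_iff]; omega

@[simp] lemma shift_ne_last (i : Fin (2 * n)) : shift i ≠ last n := (last_ne_shift i).symm

@[simp] lemma shift_inj {i j : Fin (2 * n)} : shift i = shift j ↔ i = j := by
  simp [shift, Fin.ext_iff]

@[simp] lemma shift_lt_shift {i j : Fin (2 * n)} : shift i < shift j ↔ i < j := by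
  rw [Fin.lt_def, Fin.lt_def]; simp [shift]

lemma eq_first_or_shift_or_last (p : Fin (2 * (n + 1))) :
    p = first n ∨ (∃ i, p = shift i) ∨ p = last n := by
  rcases p with ⟨p, hp⟩
  rcases Nat.eq_zero_or_pos p with h | h
  · left; ext; simpa [first] using h
  · by_cases h' : p = 2 * n + 1
    · right; right; ext; simpa [last] using h'
    · right; left
      exact ⟨⟨p - 1, by omega⟩, by ext; simp [shift]; omega⟩

end Index

/-! ### Reduction of an exchange relation to the intermediate indices -/

section Reduction

variable {n : ℕ} {C : Type*} [CommRing C]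

/-- A matrix `R` of rank `n + 1` with the support of an `R`-matrix, whose restriction to the
intermediate indices becomes the matrix `R'` of rank `n` after Gaussian elimination of the
entry at `(1, 1'), (1, 1')`. -/
structure Reduces
    (R : Fin (2 * (n + 1)) × Fin (2 * (n + 1)) → Fin (2 * (n + 1)) × Fin (2 * (n + 1)) → C)
    (R' : Fin (2 * n) × Fin (2 * n) → Fin (2 * n) × Fin (2 * n) → C)
    (α β γ : C) : Prop where
  support : ∀ a b p r, (p, r) ≠ (a, b) → (p, r) ≠ (b, a) → ¬ (a = b.rev ∧ p = r.rev) →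
    R (a, b) (p, r) = 0
  first_first : R (first n, first n) (first n, first n) = 1
  first_shift : ∀ k, R (first n, shift k) (first n, shift k) = α
  shift_first : ∀ k, R (shift k, first n) (shift k, first n) = α
  lower : ∀ k, R (shift k, first n) (first n, shift k) = β
  upper : ∀ k, R (first n, shift k) (shift k, first n) = γ
  isUnit_diag : IsUnit α
  isUnit_pivot : IsUnit (R (first n, last n) (first n, last n))
  -- The Schur complement formula is multiplied by the pivot: without inverses it passes through any
  -- ring homomorphism.
  elim : ∀ a b p r, R' (a, b) (p, r) * R (first n, last n) (first n, last n) =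
    R (shift a, shift b) (shift p, shift r) * R (first n, last n) (first n, last n) -
      R (shift a, shift b) (first n, last n) * R (first n, last n) (shift p, shift r)

variable
  {R : Fin (2 * (n + 1)) × Fin (2 * (n + 1)) → Fin (2 * (n + 1)) × Fin (2 * (n + 1)) → C}
  {R' : Fin (2 * n) × Fin (2 * n) → Fin (2 * n) × Fin (2 * n) → C} {α β γ : C}

namespace Reduces

lemma map {D : Type*} [CommRing D] (h : Reduces R R' α β γ) (f : C →+* D) :
    Reduces (fun x y => f (R x y)) (fun x y => f (R' x y)) (f α) (f β) (f γ) where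
  support a b p r h₁ h₂ h₃ := by simp [h.support a b p r h₁ h₂ h₃]
  first_first := by simp [h.first_first]
  first_shift k := by simp [h.first_shift]
  shift_first k := by simp [h.shift_first]
  lower k := by simp [h.lower]
  upper k := by simp [h.upper]
  isUnit_diag := h.isUnit_diag.map f
  isUnit_pivot := h.isUnit_pivot.map f
  elim a b p r := by
    simpa using congrArg f (h.elim a b p r)

/-- The right side of an exchange relation sums over the row index of the R-matrix, so there the
same elimination is needed for columns. -/
lemma transpose (h : Reduces R R' α β γ) :
    Reduces (fun x y => R y x) (fun x y => R' y x) α γ β where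
  support a b p r h₁ h₂ h₃ := by
    refine h.support p r a b h₁.symm ?_ (fun h => h₃ ⟨h.2, h.1⟩)
    simp only [ne_eq, Prod.mk.injEq, not_and] at h₂ ⊢
    exact fun h₄ h₅ => h₂ h₅.symm h₄.symm
  first_first := h.first_first
  first_shift := h.first_shift
  shift_first := h.shift_first
  lower := h.upper
  upper := h.lower
  isUnit_diag := h.isUnit_diag
  isUnit_pivot := h.isUnit_pivot
  elim a b p r := by
    rw [h.elim, mul_comm (R (shift p, shift r) (first n, last n))]

variable {A : Type*} [Ring A] [Algebra C A]

lemma wsum_first_first (h : Reduces R R' α β γ)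
    (f : Fin (2 * (n + 1)) × Fin (2 * (n + 1)) → A) :
    wsum (R (first n, first n)) f = f (first n, first n) := by
  rw [wsum, Finset.sum_eq_single (first n, first n)]
  · rw [h.first_first, one_smul]
  · rintro ⟨p, r⟩ - hx
    rw [h.support _ _ _ _ hx hx (by simp), zero_smul]
  · simp

lemma wsum_first_shift (h : Reduces R R' α β γ) (k : Fin (2 * n))
    (f : Fin (2 * (n + 1)) × Fin (2 * (n + 1)) → A) :
    wsum (R (first n, shift k)) f = α • f (first n, shift k) + γ • f (shift k, first n) := by
  classical
  rw [wsum, ← Finset.sum_subset (Finset.subset_univ {(first n, shift k), (shift k, first n)}),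
    Finset.sum_pair (by simp), h.first_shift, h.upper]
  rintro ⟨p, r⟩ - hx
  simp only [Finset.mem_insert, Finset.mem_singleton, not_or] at hx
  rw [h.support _ _ _ _ hx.1 hx.2 (by simp), zero_smul]

lemma wsum_shift_first (h : Reduces R R' α β γ) (k : Fin (2 * n))
    (f : Fin (2 * (n + 1)) × Fin (2 * (n + 1)) → A) :
    wsum (R (shift k, first n)) f = α • f (shift k, first n) + β • f (first n, shift k) := by
  classical
  rw [wsum, ← Finset.sum_subset (Finset.subset_univ {(shift k, first n), (first n, shift k)}),
    Finset.sum_pair (by simp), h.shift_first, h.lower]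
  rintro ⟨p, r⟩ - hx
  simp only [Finset.mem_insert, Finset.mem_singleton, not_or] at hx
  rw [h.support _ _ _ _ hx.1 hx.2 (by simp), zero_smul]

/-- The multiple of the row `(1, 1')` to be subtracted from the row `(a, b)`. -/
lemma exists_elim (h : Reduces R R' α β γ) (a b : Fin (2 * n)) : ∃ c : C,
    ∀ f : Fin (2 * (n + 1)) × Fin (2 * (n + 1)) → A, (∀ p, f (p, first n) = 0) →
      wsum (R (shift a, shift b)) f - c • wsum (R (first n, last n)) f =
        wsum (R' (a, b)) (fun x => f (shift x.1, shift x.2)) := by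
  obtain ⟨δ, hδ⟩ := h.isUnit_pivot
  have hδ' : R (first n, last n) (first n, last n) * ↑δ⁻¹ = 1 := by rw [← hδ, Units.mul_inv]
  -- Entry over pivot: this multiplier clears the column `(1, 1')`.
  refine ⟨R (shift a, shift b) (first n, last n) * ↑δ⁻¹, fun f hf => ?_⟩
  rw [← wsum_sub_weight]
  symm
  refine Fintype.sum_of_injective (fun x : Fin (2 * n) × Fin (2 * n) => (shift x.1, shift x.2))
    (fun x y hxy => by simpa [Prod.ext_iff] using hxy) _ _ ?_ ?_
  · rintro ⟨p, r⟩ hx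
    have key : ∀ p r, (∀ i j, (p, r) ≠ (shift i, shift j)) → (p, r) ≠ (first n, last n) →
        (p, r) ≠ (last n, first n) → p ≠ r.rev →
        R (shift a, shift b) (p, r) = 0 ∧ R (first n, last n) (p, r) = 0 := by
      intro p r h₁ h₂ h₃ h₄
      exact ⟨h.support _ _ _ _ (h₁ _ _) (h₁ _ _) (fun h => h₄ h.2),
        h.support _ _ _ _ h₂ h₃ (fun h => h₄ h.2)⟩
    have zero : ∀ p r, (∀ i j, (p, r) ≠ (shift i, shift j)) → (p, r) ≠ (first n, last n) →
        (p, r) ≠ (last n, first n) → p ≠ r.rev →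
        (R (shift a, shift b) (p, r) - R (shift a, shift b) (first n, last n) * ↑δ⁻¹ *
          R (first n, last n) (p, r)) • f (p, r) = 0 := by
      intro p r h₁ h₂ h₃ h₄
      obtain ⟨h₅, h₆⟩ := key p r h₁ h₂ h₃ h₄
      rw [h₅, h₆, mul_zero, sub_zero, zero_smul]
    rcases eq_first_or_shift_or_last r with rfl | ⟨j, rfl⟩ | rfl
    -- The column `(1', 1)` is not cleared by the elimination; `f` vanishes on it.
    · rw [hf, smul_zero]
    · rcases eq_first_or_shift_or_last p with rfl | ⟨i, rfl⟩ | rfl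
      · exact zero _ _ (by simp) (by simp) (by simp) (by simp)
      · exact absurd ⟨(i, j), rfl⟩ hx
      · exact zero _ _ (by simp) (by simp) (by simp) (by simp)
    · rcases eq_first_or_shift_or_last p with rfl | ⟨i, rfl⟩ | rfl
      · dsimp only
        rw [mul_assoc, mul_comm (↑δ⁻¹ : C), hδ', mul_one, sub_self, zero_smul]
      · exact zero _ _ (by simp) (by simp) (by simp) (by simp)
      · exact zero _ _ (by simp) (by simp) (by simp) (by simp)
  · rintro ⟨p, r⟩
    have := congrArg (· * (↑δ⁻¹ : C)) (h.elim a b p r)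
    simp only [sub_mul, mul_assoc, hδ', mul_one] at this
    dsimp only
    rw [this]
    congr 2
    ring

end Reduces

/-! ### Schur complements in an exchange relation -/

section Exchange

variable {A : Type*} [Ring A] [Algebra C A]
  {T : Fin (2 * (n + 1)) × Fin (2 * (n + 1)) → Fin (2 * (n + 1)) × Fin (2 * (n + 1)) → C}
  {T' : Fin (2 * n) × Fin (2 * n) → Fin (2 * n) × Fin (2 * n) → C} {α' β' γ' : C}
  {L M : Fin (2 * (n + 1)) → Fin (2 * (n + 1)) → A} {Li Mi : A}

/-- The Schur complement of the matrix `L` with respect to its first entry, whose inverse is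
`Li`. -/
def schur (L : Fin (2 * (n + 1)) → Fin (2 * (n + 1)) → A) (Li : A)
    (i j : Fin (2 * (n + 1))) : A :=
  L i j - L i (first n) * Li * L (first n) j

lemma schur_first_left (hL : L (first n) (first n) * Li = 1) (j : Fin (2 * (n + 1))) :
    schur L Li (first n) j = 0 := by
  rw [schur, hL, one_mul, sub_self]

lemma schur_first_right (hL : Li * L (first n) (first n) = 1) (i : Fin (2 * (n + 1))) :
    schur L Li i (first n) = 0 := by
  rw [schur, mul_assoc, hL, mul_one, sub_self]

/-- Elimination of the first row and column of the second factor of an exchange relation. -/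
lemma exchange_schur_right
    (hrel : ∀ a b j l, wsum (R (a, b)) (fun x => L x.1 j * M x.2 l) =
      wsum (T (j, l)) (fun x => M b x.2 * L a x.1))
    (a b j l : Fin (2 * (n + 1))) :
    wsum (R (a, b)) (fun x => L x.1 j * schur M Mi x.2 l) -
        M b (first n) * Mi * wsum (R (a, first n)) (fun x => L x.1 j * schur M Mi x.2 l) =
      wsum (T (j, l)) (fun x => schur M Mi b x.2 * L a x.1) -
        wsum (T (j, first n)) (fun x => schur M Mi b x.2 * L a x.1) *
          (Mi * M (first n) l) := by
  -- Subtracting the relation for `(j, 1)`, multiplied on the right by `M₁₁⁻¹ M₁ₗ`, turns the second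
  -- factor on the left side into the Schur complement.
  have hX : ∀ a b, wsum (R (a, b)) (fun x => L x.1 j * schur M Mi x.2 l) =
      wsum (T (j, l)) (fun x => M b x.2 * L a x.1) -
        wsum (T (j, first n)) (fun x => M b x.2 * L a x.1) * (Mi * M (first n) l) := by
    intro a b
    rw [← hrel, ← hrel, ← wsum_mul, ← wsum_sub]
    simp only [schur, mul_sub, mul_assoc]
  -- The same correction from the left, with `M_{b1} M₁₁⁻¹` times the row `(a, 1)`, turns `M b` into
  -- the Schur complement on the right side.
  rw [hX, hX]
  simp only [schur, sub_mul, wsum_sub, mul_sub]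
  simp only [mul_assoc, wsum_mul_left]
  abel

/-- If `R L₁ M₂ = M₂ L₁ Tᵗ` in rank `n + 1`, then the Schur complements of `L` and `M` with
respect to their first entries satisfy the reduced relation in rank `n`. -/
theorem exchange_schur (hR : Reduces R R' α β γ) (hT : Reduces T T' α' β' γ')
    (hL : L (first n) (first n) * Li = 1) (hL' : Li * L (first n) (first n) = 1)
    (hM : M (first n) (first n) * Mi = 1) (hM' : Mi * M (first n) (first n) = 1)
    (hrel : ∀ a b j l, wsum (R (a, b)) (fun x => L x.1 j * M x.2 l) =
      wsum (T (j, l)) (fun x => M b x.2 * L a x.1))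
    (a b j l : Fin (2 * n)) :
    wsum (R' (a, b))
        (fun x => schur L Li (shift x.1) (shift j) * schur M Mi (shift x.2) (shift l)) =
      wsum (T' (j, l))
        (fun x => schur M Mi (shift b) (shift x.2) * schur L Li (shift a) (shift x.1)) := by
  obtain ⟨c, hc⟩ := hR.exists_elim (A := A) a b
  obtain ⟨c', hc'⟩ := hT.exists_elim (A := A) j l
  obtain ⟨αi, hαi⟩ : ∃ y, y * α = 1 := hR.isUnit_diag.exists_left_inv
  obtain ⟨αi', hαi'⟩ : ∃ y, y * α' = 1 := hT.isUnit_diag.exists_left_inv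
  set N := schur M Mi with hN
  set o := first n with ho
  set E : Fin (2 * (n + 1)) → A := fun p => Li * L o p with hE
  set E' : Fin (2 * (n + 1)) → A := fun p => Mi * M o p with hE'
  have hNl : ∀ l, N o l = 0 := schur_first_left hM
  have hSl : ∀ j, schur L Li o j = 0 := schur_first_left hL
  have hNr : ∀ b, N b o = 0 := schur_first_right hM'
  have hLE : ∀ p, L o o * E p = L o p := fun p => by rw [hE, ← mul_assoc, hL, one_mul]
  have Y := fun a b j l => exchange_schur_right (Mi := Mi) hrel a b j l
  rw [← hN, ← ho] at Y
  have Yfirst : ∀ a b l, wsum (R (a, b)) (fun x => L x.1 o * N x.2 l) -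
      M b o * Mi * wsum (R (a, o)) (fun x => L x.1 o * N x.2 l) =
        wsum (T (o, l)) (fun x => N b x.2 * L a x.1) := by
    intro a b l
    rw [Y, hT.wsum_first_first]
    simp only [← ho, hNr, zero_mul, sub_zero]
  have Yfirst_shift : ∀ a b l, wsum (R (a, b)) (fun x => L x.1 o * N x.2 (shift l)) -
      M b o * Mi * wsum (R (a, o)) (fun x => L x.1 o * N x.2 (shift l)) =
        α' • (N b (shift l) * L a o) := by
    intro a b l
    rw [Yfirst, hT.wsum_first_shift]
    simp only [← ho, hNr, zero_mul, smul_zero, add_zero]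
  have Yshift : ∀ a b j l, wsum (R (a, b)) (fun x => L x.1 (shift j) * N x.2 l) -
      M b o * Mi * wsum (R (a, o)) (fun x => L x.1 (shift j) * N x.2 l) =
        wsum (T (shift j, l)) (fun x => N b x.2 * L a x.1) -
          β' • (N b (shift j) * L a o * E' l) := by
    intro a b j l
    rw [Y, hT.wsum_shift_first]
    simp only [← ho, hNr, zero_mul, smul_zero, zero_add, smul_mul_assoc, hE']
  -- This is the relation for the row `(1, k)` and the column `(1, l)`. It allows `L₁₁` to be moved
  -- across `N` below.
  have comm : ∀ k l, α • (L o o * N (shift k) (shift l)) =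
      α' • (N (shift k) (shift l) * L o o) := by
    intro k l
    rw [← Yfirst_shift, hR.wsum_first_shift, hR.wsum_first_first]
    simp only [← ho, hNl, mul_zero, smul_zero, add_zero, sub_zero]
  -- `F` combines the columns `(j, l)` and `(1, 1')` with the elimination multiplier of `T`, so that
  -- only `T'` remains on the right side.
  set F : Fin (2 * (n + 1)) × Fin (2 * (n + 1)) → A := fun x =>
    L x.1 (shift j) * N x.2 (shift l) - c' • (L x.1 o * N x.2 (last n)) with hF
  -- `H` is chosen so that `F (1, k) = L₁₁ H k`: in the row `(1, k)` of `YF`, each `L₁ₚ` is written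
  -- as `L₁₁ E p`, and `L₁₁` is then moved to the left by `comm`.
  set H : Fin (2 * (n + 1)) → A := fun r =>
    αi' • (wsum (T' (j, l)) (fun x => N r (shift x.2) * E (shift x.1)) -
      β' • (N r (shift j) * E' (shift l))) with hH
  have YF : ∀ a b, wsum (R (a, b)) F - M b o * Mi * wsum (R (a, o)) F =
      wsum (T' (j, l)) (fun x => N b (shift x.2) * L a (shift x.1)) -
        β' • (N b (shift j) * L a o * E' (shift l)) := by
    intro a b
    rw [hF, wsum_sub, wsum_sub, wsum_smul, wsum_smul,
      ← hc' (fun x => N b x.2 * L a x.1) (fun p => by simp only [hNr, zero_mul]),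
      ← Yfirst, sub_right_comm (wsum (T (shift j, shift l)) _), ← Yshift, mul_sub, mul_smul_comm, smul_sub]
    abel
  have F_first : ∀ k, F (o, shift k) = L o o * H (shift k) := by
    intro k
    have h₁ : α • F (o, shift k) = α • (L o o * H (shift k)) := by
      have h₂ := YF o (shift k)
      rw [hR.wsum_first_shift, hR.wsum_first_first] at h₂
      have h₃ : ∀ p, F (p, o) = 0 := fun p => by simp [hF, hNl]
      rw [← ho, h₃, h₃, smul_zero, add_zero, mul_zero, sub_zero] at h₂
      rw [h₂, hH]
      have h₄ : ∀ (r : Fin (2 * n)) (y : A), N (shift k) (shift r) * (L o o * y) =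
          (αi' * α) • (L o o * (N (shift k) (shift r) * y)) := by
        intro r y
        have := congrArg (αi' • ·) (comm k r)
        simp only [smul_smul, hαi', one_smul] at this
        rw [← mul_assoc, ← this, smul_mul_assoc, mul_assoc]
      simp only [← hLE (shift _), mul_assoc, h₄, wsum_smul, wsum_mul_left, mul_smul_comm,
        mul_sub, smul_sub, smul_smul]
      congr 2 <;> ring
    have := congrArg (αi • ·) h₁
    simpa only [smul_smul, hαi, one_smul] using this
  -- Since `H k = L₁₁⁻¹ F (1, k)`, subtracting `L_{p1} H k` completes the Schur complement of `L`,
  -- and the two terms with `c'` cancel.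
  have LN : ∀ p k, schur L Li p (shift j) * N (shift k) (shift l) =
      F (p, shift k) - L p o * H (shift k) := by
    intro p k
    have h₁ : Li * F (o, shift k) = H (shift k) := by
      rw [F_first, ← mul_assoc, hL', one_mul]
    rw [← h₁, schur, hF]
    simp only [mul_sub, sub_mul, mul_smul_comm, mul_assoc, ← ho]
    rw [← mul_assoc Li (L o o), hL', one_mul]
    abel
  set G : Fin (2 * (n + 1)) × Fin (2 * (n + 1)) → A := fun x => F x - L x.1 o * H x.2 with hG
  -- the rows `(a, b)` and `(1, 1')` treated together
  have row : ∀ (a b) (m : C),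
      (∀ j l, wsum (R (a, o)) (fun x => L x.1 j * N x.2 l) = m • (L o j * N a l)) →
      m • F (o, a) = m • (L o o * H a) →
      wsum (R (a, b)) G =
        wsum (T' (j, l)) (fun x => N b (shift x.2) * schur L Li a (shift x.1)) := by
    intro a b m hm hFm
    have h₁ : wsum (R (a, o)) F = m • (L o o * H a) := by
      rw [← hFm, hF, wsum_sub, wsum_smul, hm, hm, smul_sub, smul_comm c']
    have h₂ : ∀ r, wsum (R (a, b)) (fun x => L x.1 o * N x.2 (shift r)) =
        α' • (N b (shift r) * L a o) + M b o * Mi * m • (L o o * N a (shift r)) := by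
      intro r
      rw [← Yfirst_shift, hm, sub_add_cancel]
    have h₃ : wsum (R (a, b)) F =
        wsum (T' (j, l)) (fun x => N b (shift x.2) * L a (shift x.1)) -
        β' • (N b (shift j) * L a o * E' (shift l)) + M b o * Mi * m • (L o o * H a) := by
      rw [← YF, h₁, sub_add_cancel]
    have h₄ : wsum (R (a, b)) (fun x => L x.1 o * H x.2) =
        αi' • (wsum (T' (j, l)) (fun y => wsum (R (a, b))
            (fun x => L x.1 o * N x.2 (shift y.2)) * E (shift y.1)) -
          β' • (wsum (R (a, b)) (fun x => L x.1 o * N x.2 (shift j)) * E' (shift l))) := by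
      simp only [← wsum_mul]
      rw [← wsum_comm]
      simp only [← wsum_smul, ← wsum_sub, hH, mul_smul_comm, mul_sub, ← wsum_mul_left, mul_assoc]
    have h₅ : ∀ y : A, αi' • α' • y = y := fun y => by rw [smul_smul, hαi', one_smul]
    -- Expanding `H` here makes the terms with `M_{b1} M₁₁⁻¹` in `h₃` and `h₄` cancel; the terms
    -- with `E'` cancel as well, and `L - L_{·1} E` remains.
    have h₆ : M b o * Mi * m • (L o o * H a) =
        αi' • (wsum (T' (j, l)) (fun y => M b o * Mi * m • (L o o * N a (shift y.2)) *
            E (shift y.1)) -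
          β' • (M b o * Mi * m • (L o o * N a (shift j)) * E' (shift l))) := by
      simp only [hH, mul_smul_comm, smul_mul_assoc, mul_assoc, mul_sub, smul_sub,
        wsum_mul_left, wsum_smul, smul_comm m]
    rw [hG, wsum_sub, h₃, h₄, h₆]
    simp only [h₂, add_mul, wsum_add, smul_mul_assoc, wsum_smul, smul_add, smul_sub,
      smul_comm β' α', h₅]
    simp only [schur, mul_sub, wsum_sub, mul_assoc, hE, ← ho]
    abel
  have hG0 : ∀ p, G (p, o) = 0 := fun p => by
    simp [hG, hF, hH, hNl, wsum_zero]
  -- Elimination of rows in `R`. The row `(1, 1')` contributes nothing, since the first row of the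
  -- Schur complement of `L` is zero.
  have := hc G hG0
  rw [row (shift a) (shift b) β (fun j l => by rw [hR.wsum_shift_first]; simp [← ho, hNl])
    (by rw [F_first]), row o (last n) 0 (fun j l => by rw [hR.wsum_first_first]; simp [← ho, hNl])
    (by simp)] at this
  simp only [hSl, mul_zero, wsum_zero, smul_zero, sub_zero] at this
  rw [this]
  simp only [LN, hG]

end Exchange

end Reduction

/-! ### The entries of the `R`-matrix -/

section Entries

variable {K : Type*} [Field K] (q : K) (n : ℕ)

lemma e_kronecker_apply (x y x' y' i k j l : Fin (2 * n)) :
    ((e x y : Matrix _ _ K⟦X⟧) ⊗ₖ e x' y') (i, k) (j, l) =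
      if x = i ∧ y = j ∧ x' = k ∧ y' = l then 1 else 0 := by
  simp only [e, Matrix.kroneckerMap_apply, Matrix.single_apply]
  by_cases h₁ : x = i ∧ y = j <;> by_cases h₂ : x' = k ∧ y' = l <;> simp [h₁, h₂]

/-- `(q u - q⁻¹)⁻¹` -/
def typeADen : K⟦X⟧ := (PowerSeries.C q * PowerSeries.X - PowerSeries.C q⁻¹)⁻¹

/-- `((u - q⁻²) (u - ξ))⁻¹` -/
def conjDen : K⟦X⟧ := ((PowerSeries.X - PowerSeries.C (q ^ 2)⁻¹) *
  (PowerSeries.X - PowerSeries.C (xi q n)))⁻¹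

lemma Rbar_apply (i k j l : Fin (2 * n)) :
    Rbar q n (i, k) (j, l) =
      (if i = j ∧ i = k ∧ i = l then 1 else 0)
      + (PowerSeries.X - 1) * typeADen q * (if i = j ∧ k = l ∧ i ≠ k ∧ i ≠ k.rev then 1 else 0)
      + PowerSeries.C (q - q⁻¹) * typeADen q *
          (if i = l ∧ k = j ∧ j < i ∧ i ≠ j.rev then 1 else 0)
      + PowerSeries.C (q - q⁻¹) * PowerSeries.X * typeADen q *
          (if i = l ∧ k = j ∧ i < j ∧ i ≠ j.rev then 1 else 0)
      + conjDen q n * (if i = k.rev ∧ j = l.rev then aCoef q n k l else 0) := by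
  have h₁ : ∀ f : Fin (2 * n) → K⟦X⟧,
      (∑ x, if x = i ∧ x = j ∧ x = k ∧ x = l then f x else 0) =
        if i = j ∧ i = k ∧ i = l then f i else 0 := by
    intro f
    rw [Finset.sum_eq_single i] <;> simp +contextual
  have hite : ∀ (c : Prop) [Decidable c] (N : Matrix (Fin (2 * n) × Fin (2 * n))
      (Fin (2 * n) × Fin (2 * n)) K⟦X⟧),
      (if c then N else 0) (i, k) (j, l) = if c then N (i, k) (j, l) else 0 := by
    intro c _ N
    split_ifs <;> rfl
  have h₂ : ∀ (g : Fin (2 * n) → Fin (2 * n) → Prop) [∀ x y, Decidable (g x y)],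
      (∑ x, ∑ y, (if g x y then (e x x : Matrix _ _ K⟦X⟧) ⊗ₖ e y y else 0)) (i, k) (j, l) =
        if i = j ∧ k = l ∧ g i k then 1 else 0 := by
    intro g _
    simp only [Matrix.sum_apply, hite, e_kronecker_apply]
    rw [Finset.sum_eq_single i, Finset.sum_eq_single k]
    · by_cases hg : g i k <;> simp [hg]
    · intro y _ hy
      by_cases hg : g i y <;> simp [hg, hy]
    · simp
    · intro x _ hx
      refine Finset.sum_eq_zero fun y _ => ?_
      by_cases hg : g x y <;> simp [hg, hx]
    · simp
  have h₃ : ∀ (g : Fin (2 * n) → Fin (2 * n) → Prop) [∀ x y, Decidable (g x y)],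
      (∑ x, ∑ y, (if g x y then (e x y : Matrix _ _ K⟦X⟧) ⊗ₖ e y x else 0)) (i, k) (j, l) =
        if i = l ∧ k = j ∧ g i j then 1 else 0 := by
    intro g _
    simp only [Matrix.sum_apply, hite, e_kronecker_apply]
    rw [Finset.sum_eq_single i, Finset.sum_eq_single j]
    · by_cases hg : g i j <;> simp [hg, eq_comm, and_comm]
    · intro y _ hy
      by_cases hg : g i y <;> simp [hg, hy]
    · simp
    · intro x _ hx
      refine Finset.sum_eq_zero fun y _ => ?_
      by_cases hg : g x y <;> simp [hg, hx]
    · simp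
  have h₄ : (∑ x, ∑ y, aCoef q n x y • ((e x.rev y.rev : Matrix _ _ K⟦X⟧) ⊗ₖ e x y))
      (i, k) (j, l) = if i = k.rev ∧ j = l.rev then aCoef q n k l else 0 := by
    simp only [Matrix.sum_apply, Matrix.smul_apply, e_kronecker_apply]
    rw [Finset.sum_eq_single k, Finset.sum_eq_single l]
    · simp [eq_comm]
    · intro y _ hy
      simp [hy]
    · simp
    · intro x _ hx
      refine Finset.sum_eq_zero fun y _ => ?_
      simp [hx]
    · simp
  simp only [Rbar, Matrix.add_apply, Matrix.smul_apply, h₂, h₃, h₄, smul_eq_mul, typeADen, conjDen]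
  simp only [Matrix.sum_apply, e_kronecker_apply, h₁]

end Entries

/-! ### Gaussian elimination of the R-matrix -/

section Reduction

variable {K : Type*} [Field K] {q : K} {n : ℕ}

lemma conjDen_mul (hq : q ≠ 0) : conjDen q n * ((PowerSeries.X - PowerSeries.C (q ^ 2)⁻¹) *
    (PowerSeries.X - PowerSeries.C (xi q n))) = 1 := by
  refine PowerSeries.inv_mul_cancel _ ?_
  simp [xi, hq]

lemma isUnit_conjDen (hq : q ≠ 0) : IsUnit (conjDen q n) :=
  IsUnit.of_mul_eq_one _ (conjDen_mul hq)

lemma isUnit_typeADen (hq : q ≠ 0) : IsUnit (typeADen q) :=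
  IsUnit.of_mul_eq_one _ (PowerSeries.inv_mul_cancel _ (by simp [hq]))

lemma xi_eq (hq : q ≠ 0) : xi q n = q ^ 2 * xi q (n + 1) := by
  simp only [xi, Nat.mul_succ, pow_add]
  field_simp

@[simp] lemma bar_shift (i : Fin (2 * n)) : bar (n + 1) (shift i) = bar n i := by
  simp only [bar, shift]
  split_ifs <;> push_cast <;> omega

@[simp] lemma shift_lt_last (i : Fin (2 * n)) : shift i < last n := by
  rw [Fin.lt_def]; simp [shift, last]

@[simp] lemma first_lt_shift (i : Fin (2 * n)) : first n < shift i := by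
  rw [Fin.lt_def]; simp [shift, first]

/-- The elimination identity with the denominators cleared. In the product of the entries `(b, 1')`
and `(1', r)` the powers of `q` attached to `1'` cancel, which leaves `q^{b̄ - r̄}`. The terms with
`δ` agree directly; the others agree because `ξ` is multiplied by `q²` when the rank drops by one.
-/
lemma aCoef_elim (hq : q ≠ 0) (b r : Fin (2 * n)) :
    aCoef q n b r * aCoef q (n + 1) (last n) (last n) *
        (PowerSeries.X - PowerSeries.C (xi q (n + 1))) =
      (PowerSeries.X - PowerSeries.C (xi q n)) *
        (aCoef q (n + 1) (shift b) (shift r) * aCoef q (n + 1) (last n) (last n) -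
          aCoef q (n + 1) (shift b) (last n) * aCoef q (n + 1) (last n) (shift r)) := by
  have hC : (PowerSeries.C (q ^ 2) : K⟦X⟧) * PowerSeries.C (q ^ 2)⁻¹ = 1 := by
    rw [← map_mul, mul_inv_cancel₀ (pow_ne_zero _ hq), map_one]
  have hpow : (PowerSeries.C (q ^ (bar n b - bar (n + 1) (last n))) : K⟦X⟧) *
      PowerSeries.C (q ^ (bar (n + 1) (last n) - bar n r)) =
        PowerSeries.C (q ^ (bar n b - bar n r)) := by
    rw [← map_mul, ← zpow_add₀ hq]
    congr 2
    ring
  have h₁ : aCoef q (n + 1) (last n) (last n) =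
      (PowerSeries.C (q ^ 2)⁻¹ * PowerSeries.X - PowerSeries.C (xi q (n + 1))) *
        (PowerSeries.X - 1) := by
    simp [aCoef]
  have h₂ : aCoef q (n + 1) (shift b) (last n) * aCoef q (n + 1) (last n) (shift r) =
      (PowerSeries.C (q ^ 2)⁻¹ - 1) ^ 2 * PowerSeries.C (q ^ (bar n b - bar n r)) *
        PowerSeries.C (xi q (n + 1)) * PowerSeries.X * (PowerSeries.X - 1) ^ 2 := by
    rw [← hpow]
    simp only [aCoef, shift_ne_last, last_ne_shift, if_false, shift_lt_last, if_true, bar_shift,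
      (shift_lt_last r).not_gt, rev_last, shift_ne_first, rev_shift, map_sub, map_one]
    ring
  rw [h₁, h₂]
  simp only [aCoef, shift_inj, rev_shift, shift_lt_shift, bar_shift, xi_eq (n := n) hq, map_mul]
  rcases eq_or_ne b r with rfl | hbr
  · simp only [if_true, sub_self, zpow_zero, map_one]
    generalize (PowerSeries.C (q ^ 2) : K⟦X⟧) = s at *
    generalize (PowerSeries.C (q ^ 2)⁻¹ : K⟦X⟧) = t at *
    generalize (PowerSeries.C (xi q (n + 1)) : K⟦X⟧) = x at *
    linear_combination (PowerSeries.X - 1) ^ 2 * (PowerSeries.X - x) * x * PowerSeries.X *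
      (t - 1) * hC
  · simp only [hbr, if_false, map_sub, map_one]
    generalize PowerSeries.C (q ^ (bar n b - bar n r)) = w
    generalize (if b = r.rev then (1 : K⟦X⟧) else 0) = δ
    generalize (PowerSeries.C (q ^ 2) : K⟦X⟧) = s at *
    generalize (PowerSeries.C (q ^ 2)⁻¹ : K⟦X⟧) = t at *
    generalize (PowerSeries.C (xi q (n + 1)) : K⟦X⟧) = x at *
    split_ifs
    · linear_combination (t - 1) * w * x * (PowerSeries.X - 1) ^ 2 * (PowerSeries.X - x) *
        PowerSeries.X * hC
    · linear_combination (t - 1) * w * x * (PowerSeries.X - 1) ^ 2 * (PowerSeries.X - x) *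
        PowerSeries.X * hC

/-- Gaussian elimination turns the `R`-matrix of rank `n + 1` into the one of rank `n`. -/
theorem reduces_Rbar (hq : q ≠ 0) : Reduces (fun x y => Rbar q (n + 1) x y)
    (fun x y => Rbar q n x y) ((PowerSeries.X - 1) * typeADen q)
    (PowerSeries.C (q - q⁻¹) * typeADen q)
    (PowerSeries.C (q - q⁻¹) * PowerSeries.X * typeADen q) where
  support a b p r h₁ h₂ h₃ := by
    simp only [ne_eq, Prod.mk.injEq] at h₁ h₂
    rw [Rbar_apply, if_neg, if_neg, if_neg, if_neg, if_neg h₃]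
    · ring
    all_goals grind
  first_first := by simp [Rbar_apply]
  first_shift k := by simp [Rbar_apply]
  shift_first k := by simp [Rbar_apply]
  lower k := by simp [Rbar_apply, (first_lt_shift k).not_gt]
  upper k := by simp [Rbar_apply, (first_lt_shift k).not_gt]
  isUnit_diag := by
    refine IsUnit.mul ?_ (isUnit_typeADen hq)
    rw [PowerSeries.isUnit_iff_constantCoeff]
    simp
  isUnit_pivot := by
    have : Rbar q (n + 1) (first n, last n) (first n, last n) =
      conjDen q (n + 1) * aCoef q (n + 1) (last n) (last n) := by simp [Rbar_apply]
    rw [this]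
    refine (isUnit_conjDen hq).mul ?_
    rw [PowerSeries.isUnit_iff_constantCoeff]
    simp [aCoef, xi, hq]
  elim a b p r := by
    have h₁ : Rbar q (n + 1) (first n, last n) (first n, last n) =
      conjDen q (n + 1) * aCoef q (n + 1) (last n) (last n) := by simp [Rbar_apply]
    have h₂ : Rbar q (n + 1) (shift a, shift b) (first n, last n) =
        conjDen q (n + 1) * (if a = b.rev then aCoef q (n + 1) (shift b) (last n) else 0) := by
      simp [Rbar_apply]
    have h₃ : Rbar q (n + 1) (first n, last n) (shift p, shift r) =
        conjDen q (n + 1) * (if p = r.rev then aCoef q (n + 1) (last n) (shift r) else 0) := by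
      simp [Rbar_apply]
    rw [h₁, h₂, h₃, Rbar_apply, Rbar_apply]
    simp only [shift_inj, shift_lt_shift, rev_shift, ne_eq]
    -- If `(a, b)` or `(p, r)` is not a conjugate pair, the correction vanishes and the entries of
    -- both ranks coincide.
    by_cases hab : a = b.rev
    · by_cases hpr : p = r.rev
      · have h₄ := aCoef_elim hq b r
        have h₅ := conjDen_mul (n := n) hq
        have h₆ := conjDen_mul (n := n + 1) hq
        simp only [hab, hpr, and_self, if_true]
        -- The factor `u - q⁻²` is common to the denominators of both ranks, so only the factors `u
        -- - ξ` have to be exchanged.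
        linear_combination conjDen q n * conjDen q (n + 1) ^ 2 *
            (PowerSeries.X - PowerSeries.C (q ^ 2)⁻¹) * h₄ -
          conjDen q n * conjDen q (n + 1) * aCoef q n b r *
            aCoef q (n + 1) (last n) (last n) * h₆ +
          conjDen q (n + 1) ^ 2 *
            (aCoef q (n + 1) (shift b) (shift r) * aCoef q (n + 1) (last n) (last n) -
              aCoef q (n + 1) (shift b) (last n) * aCoef q (n + 1) (last n) (shift r)) * h₅
      · simp [hpr]
    · simp [hab]

end Reduction

/-! ### Formal series in two variables -/

section Series

variable {B : Type*} [Ring B]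

/-- The series `∑ s_m x^m y^m`. -/
def diag : B⟦X⟧ →+* B⟦X⟧⟦X⟧ where
  toFun s := PowerSeries.mk fun m => PowerSeries.X ^ m * PowerSeries.C (PowerSeries.coeff m s)
  map_zero' := by ext; simp
  map_one' := by
    ext d c
    simp only [PowerSeries.coeff_mk, PowerSeries.coeff_one]
    split_ifs with h <;> simp [h, PowerSeries.coeff_one]
  map_add' s t := by ext; simp [mul_add]
  map_mul' s t := by
    ext1 d
    simp only [PowerSeries.coeff_mk, PowerSeries.coeff_mul, map_sum, map_mul, Finset.mul_sum]
    refine Finset.sum_congr rfl fun x hx => ?_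
    rw [← Finset.HasAntidiagonal.mem_antidiagonal.1 hx, pow_add, mul_assoc, mul_assoc, ← mul_assoc (_ ^ x.2),
      (PowerSeries.commute_X_pow (PowerSeries.C (PowerSeries.coeff x.1 s)) x.2).symm.eq, mul_assoc]

/-- The series `∑ s_m x^m`. -/
def inFirst : B⟦X⟧ →+* B⟦X⟧⟦X⟧ := PowerSeries.C

/-- The series `∑ s_m y^m`. -/
def inSecond : B⟦X⟧ →+* B⟦X⟧⟦X⟧ := PowerSeries.map PowerSeries.C

/-- The coefficient at `x^c y^d`, which is zero unless `c` and `d` are nonnegative. -/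
def zcoeff (c d : ℤ) : B⟦X⟧⟦X⟧ →+ B where
  toFun F := if 0 ≤ c ∧ 0 ≤ d then PowerSeries.coeff c.toNat (PowerSeries.coeff d.toNat F) else 0
  map_zero' := by simp
  map_add' F G := by split_ifs <;> simp

lemma zcoeff_natCast (c d : ℕ) (F : B⟦X⟧⟦X⟧) :
    zcoeff c d F = PowerSeries.coeff c (PowerSeries.coeff d F) := by
  simp [zcoeff]

lemma zcoeff_of_neg {c d : ℤ} (h : c < 0 ∨ d < 0) (F : B⟦X⟧⟦X⟧) : zcoeff c d F = 0 := by
  simp only [zcoeff, AddMonoidHom.coe_mk, ZeroHom.coe_mk]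
  rw [if_neg (by omega)]

lemma zcoeff_ext {F G : B⟦X⟧⟦X⟧} (h : ∀ c d, zcoeff c d F = zcoeff c d G) : F = G := by
  ext d c
  rw [← zcoeff_natCast, ← zcoeff_natCast, h]

lemma zcoeff_inFirst_mul (r : B⟦X⟧) (G : B⟦X⟧⟦X⟧) (c d : ℤ) {N : ℕ} (hN : c < N) :
    zcoeff c d (inFirst r * G) =
      ∑ t ∈ Finset.range N, PowerSeries.coeff t r * zcoeff (c - t) d G := by
  by_cases h : c < 0 ∨ d < 0
  · rw [zcoeff_of_neg h, Finset.sum_eq_zero]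
    intro t _
    rw [zcoeff_of_neg (by omega), mul_zero]
  obtain ⟨c, rfl⟩ := Int.eq_ofNat_of_zero_le (show 0 ≤ c by omega)
  obtain ⟨d, rfl⟩ := Int.eq_ofNat_of_zero_le (show 0 ≤ d by omega)
  rw [zcoeff_natCast, inFirst, PowerSeries.coeff_C_mul, PowerSeries.coeff_mul,
    Finset.Nat.sum_antidiagonal_eq_sum_range_succ_mk]
  refine Finset.sum_subset_zero_on_sdiff (Finset.range_mono (by omega)) ?_ ?_
  · intro t ht
    simp only [Finset.mem_sdiff, Finset.mem_range] at ht
    rw [zcoeff_of_neg (by omega), mul_zero]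
  · intro t ht
    simp only [Finset.mem_range] at ht
    rw [← zcoeff_natCast, Nat.cast_sub (by omega)]

/-- The terms with `t > min c d` vanish, so a bound on either exponent suffices. -/
lemma zcoeff_diag_mul (r : B⟦X⟧) (G : B⟦X⟧⟦X⟧) (c d : ℤ) {N : ℕ} (hN : c < N ∨ d < N) :
    zcoeff c d (diag r * G) =
      ∑ t ∈ Finset.range N, PowerSeries.coeff t r * zcoeff (c - t) (d - t) G := by
  by_cases h : c < 0 ∨ d < 0
  · rw [zcoeff_of_neg h, Finset.sum_eq_zero]
    intro t _
    rw [zcoeff_of_neg (by omega), mul_zero]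
  obtain ⟨c, rfl⟩ := Int.eq_ofNat_of_zero_le (show 0 ≤ c by omega)
  obtain ⟨d, rfl⟩ := Int.eq_ofNat_of_zero_le (show 0 ≤ d by omega)
  have key : ∀ t, t ≤ d → PowerSeries.coeff c (PowerSeries.coeff t (diag r) *
      PowerSeries.coeff (d - t) G) =
        PowerSeries.coeff t r * zcoeff (c - t : ℤ) (d - t : ℤ) G := by
    intro t ht
    simp only [diag, RingHom.coe_mk, MonoidHom.coe_mk, OneHom.coe_mk, PowerSeries.coeff_mk,
      mul_assoc, PowerSeries.coeff_X_pow_mul']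
    split_ifs with h
    · rw [PowerSeries.coeff_C_mul, ← zcoeff_natCast, Nat.cast_sub h, Nat.cast_sub ht]
    · rw [zcoeff_of_neg (by omega), mul_zero]
  have zero : ∀ t : ℕ, c < t ∨ d < t →
      PowerSeries.coeff t r * zcoeff (c - t : ℤ) (d - t : ℤ) G = 0 := by
    intro t ht
    rw [zcoeff_of_neg (by omega), mul_zero]
  rw [zcoeff_natCast, PowerSeries.coeff_mul, map_sum,
    Finset.Nat.sum_antidiagonal_eq_sum_range_succ_mk,
    Finset.sum_congr rfl fun t ht => key t (by simp at ht; omega)]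
  have hle : min c d + 1 ≤ N := by omega
  trans ∑ t ∈ Finset.range (min c d + 1),
    PowerSeries.coeff t r * zcoeff (c - t : ℤ) (d - t : ℤ) G
  · refine (Finset.sum_subset (Finset.range_mono (by omega)) ?_).symm
    intro t _ ht
    exact zero t (by simp at ht; omega)
  · refine Finset.sum_subset (Finset.range_mono hle) ?_
    intro t _ ht
    exact zero t (by simp at ht; omega)

/-- The coefficient of a power series at an integral exponent. -/
abbrev pcoeff (s : B⟦X⟧) (c : ℤ) : B := seriesCoeff true (fun k => PowerSeries.coeff k s) c

lemma zcoeff_inSecond (m : B⟦X⟧) (c d : ℤ) :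
    zcoeff c d (inSecond m) = if c = 0 then pcoeff m d else 0 := by
  simp only [zcoeff, AddMonoidHom.coe_mk, ZeroHom.coe_mk, inSecond, PowerSeries.coeff_map,
    PowerSeries.coeff_C, pcoeff, seriesCoeff]
  split_ifs <;> first | rfl | omega

lemma zcoeff_inFirst (l : B⟦X⟧) (c d : ℤ) :
    zcoeff c d (inFirst l) = if d = 0 then pcoeff l c else 0 := by
  simp only [zcoeff, AddMonoidHom.coe_mk, ZeroHom.coe_mk, inFirst, PowerSeries.coeff_C, pcoeff,
    seriesCoeff]
  split_ifs <;> first | rfl | omega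

/-- Only `t = c` survives; for negative `c` both sides are zero. This collapses the convolutions for
products of two one-variable series. -/
lemma sum_pcoeff_mul_ite (l : B⟦X⟧) (f : ℕ → B) (c : ℤ) {N : ℕ} (hN : c < N) :
    ∑ t ∈ Finset.range N, PowerSeries.coeff t l * (if c - t = 0 then f t else 0) =
      pcoeff l c * f c.toNat := by
  by_cases h : 0 ≤ c
  · obtain ⟨c, rfl⟩ := Int.eq_ofNat_of_zero_le h
    rw [Finset.sum_eq_single c]
    · simp [pcoeff, seriesCoeff]
    · intro t _ ht
      rw [if_neg (by omega), mul_zero]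
    · intro h
      simp at h; omega
  · rw [Finset.sum_eq_zero]
    · simp [pcoeff, seriesCoeff, h]
    · intro t _
      rw [if_neg (by omega), mul_zero]

lemma zcoeff_inFirst_mul_inSecond (l m : B⟦X⟧) (c d : ℤ) :
    zcoeff c d (inFirst l * inSecond m) = pcoeff l c * pcoeff m d := by
  rw [zcoeff_inFirst_mul l _ c d (N := c.natAbs + 1) (by omega)]
  simp only [zcoeff_inSecond]
  exact sum_pcoeff_mul_ite l _ c (by omega)

lemma zcoeff_diag_mul_inSecond (l m : B⟦X⟧) (c d : ℤ) :
    zcoeff c d (diag l * inSecond m) = pcoeff l c * pcoeff m (d - c) := by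
  rw [zcoeff_diag_mul l _ c d (N := c.natAbs + 1) (by omega)]
  simp only [zcoeff_inSecond]
  rw [sum_pcoeff_mul_ite l (fun t => pcoeff m (d - t)) c (by omega)]
  by_cases h : 0 ≤ c
  · rw [Int.toNat_of_nonneg h]
  · simp [pcoeff, seriesCoeff, h]

lemma zcoeff_inSecond_mul (m : B⟦X⟧) (G : B⟦X⟧⟦X⟧) (c d : ℤ) {N : ℕ} (hN : d < N) :
    zcoeff c d (inSecond m * G) =
      ∑ t ∈ Finset.range N, PowerSeries.coeff t m * zcoeff c (d - t) G := by
  by_cases h : c < 0 ∨ d < 0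
  · rw [zcoeff_of_neg h, Finset.sum_eq_zero]
    intro t _
    rw [zcoeff_of_neg (by omega), mul_zero]
  obtain ⟨c, rfl⟩ := Int.eq_ofNat_of_zero_le (show 0 ≤ c by omega)
  obtain ⟨d, rfl⟩ := Int.eq_ofNat_of_zero_le (show 0 ≤ d by omega)
  rw [zcoeff_natCast, inSecond, PowerSeries.coeff_mul, map_sum,
    Finset.Nat.sum_antidiagonal_eq_sum_range_succ_mk]
  refine Finset.sum_subset_zero_on_sdiff (Finset.range_mono (by omega)) ?_ ?_
  · intro t ht
    simp only [Finset.mem_sdiff, Finset.mem_range] at ht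
    rw [zcoeff_of_neg (by omega), mul_zero]
  · intro t ht
    simp only [Finset.mem_range] at ht
    rw [PowerSeries.coeff_map, PowerSeries.coeff_C_mul, ← zcoeff_natCast,
      Nat.cast_sub (by omega)]

lemma zcoeff_inSecond_mul_inFirst (m l : B⟦X⟧) (c d : ℤ) :
    zcoeff c d (inSecond m * inFirst l) = pcoeff m d * pcoeff l c := by
  rw [zcoeff_inSecond_mul m _ c d (N := d.natAbs + 1) (by omega)]
  simp only [zcoeff_inFirst]
  exact sum_pcoeff_mul_ite m _ d (by omega)

lemma zcoeff_diag (l : B⟦X⟧) (c d : ℤ) :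
    zcoeff c d (diag l) = if d - c = 0 then pcoeff l c else 0 := by
  have := zcoeff_diag_mul_inSecond l 1 c d
  rw [map_one, mul_one] at this
  rw [this]
  simp only [pcoeff, seriesCoeff, PowerSeries.coeff_one]
  split_ifs <;> first | omega | simp

lemma zcoeff_inSecond_mul_diag (m l : B⟦X⟧) (c d : ℤ) :
    zcoeff c d (inSecond m * diag l) = pcoeff m (d - c) * pcoeff l c := by
  rw [zcoeff_inSecond_mul m _ c d (N := (d - c).natAbs + d.natAbs + 1) (by omega)]
  simp only [zcoeff_diag, sub_right_comm d _ c]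
  exact sum_pcoeff_mul_ite m _ (d - c) (by omega)

lemma commute_of_coeff {s t : B⟦X⟧}
    (h : ∀ i j, Commute (PowerSeries.coeff i s) (PowerSeries.coeff j t)) : Commute s t := by
  ext d
  rw [PowerSeries.coeff_mul, PowerSeries.coeff_mul, ← Finset.Nat.sum_antidiagonal_swap]
  exact Finset.sum_congr rfl fun x _ => h _ _

end Series

section Twist

variable {K : Type*} [Field K] {B : Type*} [Ring B] [Algebra K B]

/-- The series `f(w u) = ∑ f_t w^t u^t`. -/
def twist (w : B) : K⟦X⟧ →+* B⟦X⟧ where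
  toFun f := PowerSeries.mk fun t => PowerSeries.coeff t f • w ^ t
  map_zero' := by ext; simp
  map_one' := by
    ext d
    simp only [PowerSeries.coeff_mk, PowerSeries.coeff_one]
    split_ifs with h <;> simp [h]
  map_add' s t := by ext; simp [add_smul]
  map_mul' s t := by
    ext d
    simp only [PowerSeries.coeff_mk, PowerSeries.coeff_mul, Finset.sum_smul]
    refine Finset.sum_congr rfl fun x hx => ?_
    rw [← Finset.HasAntidiagonal.mem_antidiagonal.1 hx, pow_add, smul_mul_smul_comm]

lemma coeff_twist (w : B) (f : K⟦X⟧) (t : ℕ) :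
    PowerSeries.coeff t (twist w f) = PowerSeries.coeff t f • w ^ t := by
  simp [twist]

end Twist

/-! ### Exchange relations for formal series -/

/-- A ring of formal series in which the products `r(u / v) l(u) m(v)` make sense, for `l(u)` and
`m(v)` series in `u^{±1}` and `v^{±1}`, with the signs given by `ε₁` and `ε₂`. -/
structure Expansion (B : Type*) [Ring B] (ε₁ ε₂ : Bool) where
  /-- `r ↦ r(u / v)` -/
  ratio : B⟦X⟧ →+* B⟦X⟧⟦X⟧
  /-- `l ↦ l(u)` -/
  left : B⟦X⟧ →+* B⟦X⟧⟦X⟧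
  /-- `m ↦ m(v)` -/
  right : B⟦X⟧ →+* B⟦X⟧⟦X⟧
  /-- The coefficient at `u^a v^b`. -/
  coeffAt : ℤ → ℤ → B⟦X⟧⟦X⟧ →+ B
  ext : ∀ {F G}, (∀ a b, coeffAt a b F = coeffAt a b G) → F = G
  coeff_left_right : ∀ (r l m : B⟦X⟧) (a b : ℤ), coeffAt a b (ratio r * (left l * right m)) =
    ∑ t ∈ Finset.range (a.natAbs + b.natAbs + 1), PowerSeries.coeff t r *
      (seriesCoeff ε₁ (fun k => PowerSeries.coeff k l) (a - t) *
        seriesCoeff ε₂ (fun k => PowerSeries.coeff k m) (b + t))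
  coeff_right_left : ∀ (r l m : B⟦X⟧) (a b : ℤ), coeffAt a b (ratio r * (right m * left l)) =
    ∑ t ∈ Finset.range (a.natAbs + b.natAbs + 1), PowerSeries.coeff t r *
      (seriesCoeff ε₂ (fun k => PowerSeries.coeff k m) (b + t) *
        seriesCoeff ε₁ (fun k => PowerSeries.coeff k l) (a - t))
  central : ∀ r : B⟦X⟧, (∀ t x, Commute (PowerSeries.coeff t r) x) → ∀ F, Commute (ratio r) F

/-! ### Changes of variables for the three sign patterns -/

section Expansions

variable {B : Type*} [Ring B]

lemma seriesCoeff_false (s : B⟦X⟧) (a : ℤ) :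
    seriesCoeff false (fun k => PowerSeries.coeff k s) a = pcoeff s (-a) := by
  simp [seriesCoeff, pcoeff]

lemma inFirst_central (r : B⟦X⟧) (hr : ∀ t x, Commute (PowerSeries.coeff t r) x)
    (F : B⟦X⟧⟦X⟧) : Commute (inFirst r) F := by
  refine commute_of_coeff fun i j => ?_
  rw [inFirst, PowerSeries.coeff_C]
  split_ifs
  · exact commute_of_coeff fun t k => hr t _
  · exact Commute.zero_left _

lemma diag_central (r : B⟦X⟧) (hr : ∀ t x, Commute (PowerSeries.coeff t r) x)
    (F : B⟦X⟧⟦X⟧) : Commute (diag r) F := by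
  refine commute_of_coeff fun i j => ?_
  simp only [diag, RingHom.coe_mk, MonoidHom.coe_mk, OneHom.coe_mk, PowerSeries.coeff_mk]
  refine (PowerSeries.commute_X_pow _ _).symm.mul_left (commute_of_coeff fun t k => ?_)
  rw [PowerSeries.coeff_C]
  split_ifs
  · exact hr _ _
  · exact Commute.zero_left _

/-- Both series in nonnegative powers: `x = u / v` and `y = v`. -/
def plusPlus (B : Type*) [Ring B] : Expansion B true true where
  ratio := inFirst
  left := diag
  right := inSecond
  coeffAt a b := zcoeff a (a + b)
  ext h := zcoeff_ext fun c d => by simpa using h c (d - c)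
  coeff_left_right r l m a b := by
    rw [zcoeff_inFirst_mul r _ a _ (N := a.natAbs + b.natAbs + 1) (by omega)]
    refine Finset.sum_congr rfl fun t _ => ?_
    rw [zcoeff_diag_mul_inSecond, show a + b - (a - t) = b + t by ring]
  coeff_right_left r l m a b := by
    rw [zcoeff_inFirst_mul r _ a _ (N := a.natAbs + b.natAbs + 1) (by omega)]
    refine Finset.sum_congr rfl fun t _ => ?_
    rw [zcoeff_inSecond_mul_diag, show a + b - (a - t) = b + t by ring]
  central := inFirst_central

/-- Both series in nonpositive powers: `x = u / v` and `y = u⁻¹`. -/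
def minusMinus (B : Type*) [Ring B] : Expansion B false false where
  ratio := inFirst
  left := inSecond
  right := diag
  coeffAt a b := zcoeff (-b) (-a - b)
  ext h := zcoeff_ext fun c d => by simpa using h (c - d) (-c)
  coeff_left_right r l m a b := by
    rw [zcoeff_inFirst_mul r _ (-b) _ (N := a.natAbs + b.natAbs + 1) (by omega)]
    refine Finset.sum_congr rfl fun t _ => ?_
    rw [zcoeff_inSecond_mul_diag, seriesCoeff_false, seriesCoeff_false,
      show -a - b - (-b - t) = -(a - t) by ring, show -b - (t : ℤ) = -(b + t) by ring]
  coeff_right_left r l m a b := by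
    rw [zcoeff_inFirst_mul r _ (-b) _ (N := a.natAbs + b.natAbs + 1) (by omega)]
    refine Finset.sum_congr rfl fun t _ => ?_
    rw [zcoeff_diag_mul_inSecond, seriesCoeff_false, seriesCoeff_false,
      show -a - b - (-b - t) = -(a - t) by ring, show -b - (t : ℤ) = -(b + t) by ring]
  central := inFirst_central

/-- Nonnegative powers of `u` and nonpositive powers of `v`: `x = u` and `y = v⁻¹`. -/
def plusMinus (B : Type*) [Ring B] : Expansion B true false where
  ratio := diag
  left := inFirst
  right := inSecond
  coeffAt a b := zcoeff a (-b)
  ext h := zcoeff_ext fun c d => by simpa using h c (-d)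
  coeff_left_right r l m a b := by
    rw [zcoeff_diag_mul r _ a _ (N := a.natAbs + b.natAbs + 1) (by omega)]
    refine Finset.sum_congr rfl fun t _ => ?_
    rw [zcoeff_inFirst_mul_inSecond, seriesCoeff_false, show -b - (t : ℤ) = -(b + t) by ring]
  coeff_right_left r l m a b := by
    rw [zcoeff_diag_mul r _ a _ (N := a.natAbs + b.natAbs + 1) (by omega)]
    refine Finset.sum_congr rfl fun t _ => ?_
    rw [zcoeff_inSecond_mul_inFirst, seriesCoeff_false, show -b - (t : ℤ) = -(b + t) by ring]
  central := diag_central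

end Expansions

/-! ### From relations between coefficients to relations between series -/

section Translation

variable {K : Type*} [Field K] (q : K) {B : Type*} [Ring B] [Algebra K B]
  {ε₁ ε₂ : Bool} (D : Expansion B ε₁ ε₂)

/-- The central series `f(w u / v)` for `w` central. -/
def Expansion.weight {w : B} (hw : ∀ x, Commute w x) :
    K⟦X⟧ →+* Subring.center B⟦X⟧⟦X⟧ :=
  (D.ratio.comp (twist w)).codRestrict _ fun f => Subring.mem_center_iff.2 fun F =>
    (D.central (twist w f) (fun t x => by
      rw [coeff_twist]
      exact ((hw x).pow_left t).smul_left _) F).symm.eq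

lemma coeffAt_wsum_left {κ : Type*} [Fintype κ] {w : B} (hw : ∀ x, Commute w x) (c : κ → K⟦X⟧)
    (f g : κ → B⟦X⟧) (a b : ℤ) :
    D.coeffAt a b (wsum (fun x => D.weight hw (c x)) fun x => D.left (f x) * D.right (g x)) =
      ∑ t ∈ Finset.range (a.natAbs + b.natAbs + 1), ∑ x, PowerSeries.coeff t (c x) •
        (w ^ t * seriesCoeff ε₁ (fun k => PowerSeries.coeff k (f x)) (a - t) *
          seriesCoeff ε₂ (fun k => PowerSeries.coeff k (g x)) (b + t)) := by
  rw [wsum, map_sum, Finset.sum_comm]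
  refine Finset.sum_congr rfl fun x _ => ?_
  refine (D.coeff_left_right (twist w (c x)) (f x) (g x) a b).trans ?_
  simp only [coeff_twist, smul_mul_assoc, mul_assoc]

lemma coeffAt_wsum_right {κ : Type*} [Fintype κ] {w : B} (hw : ∀ x, Commute w x) (c : κ → K⟦X⟧)
    (f g : κ → B⟦X⟧) (a b : ℤ) :
    D.coeffAt a b (wsum (fun x => D.weight hw (c x)) fun x => D.right (g x) * D.left (f x)) =
      ∑ t ∈ Finset.range (a.natAbs + b.natAbs + 1), ∑ x, PowerSeries.coeff t (c x) •
        (seriesCoeff ε₂ (fun k => PowerSeries.coeff k (g x)) (b + t) *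
          seriesCoeff ε₁ (fun k => PowerSeries.coeff k (f x)) (a - t) * w ^ t) := by
  rw [wsum, map_sum, Finset.sum_comm]
  refine Finset.sum_congr rfl fun x _ => ?_
  refine (D.coeff_right_left (twist w (c x)) (f x) (g x) a b).trans ?_
  refine Finset.sum_congr rfl fun t _ => ?_
  rw [coeff_twist, smul_mul_assoc, ((hw _).pow_left t).eq]

/-- The exchange relations between coefficients amount to exchange relations between series. -/
theorem rtt_iff (n : ℕ) {w w' : B} (hw : ∀ x, Commute w x) (hw' : ∀ x, Commute w' x)
    (L M : Fin (2 * n) → Fin (2 * n) → B⟦X⟧) :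
    (∀ i j k l a b,
      rttLeft q n w (fun i j => seriesCoeff ε₁ fun m => PowerSeries.coeff m (L i j))
          (fun i j => seriesCoeff ε₂ fun m => PowerSeries.coeff m (M i j)) i j k l a b =
        rttRight q n w' (fun i j => seriesCoeff ε₁ fun m => PowerSeries.coeff m (L i j))
          (fun i j => seriesCoeff ε₂ fun m => PowerSeries.coeff m (M i j)) i j k l a b) ↔
    ∀ i k j l,
      wsum (fun x => D.weight hw (Rbar q n (i, k) x))
          (fun x => D.left (L x.1 j) * D.right (M x.2 l)) =
        wsum (fun x => D.weight hw' (Rbar q n x (j, l)))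
          (fun x => D.right (M k x.2) * D.left (L i x.1)) := by
  have key : ∀ i j k l a b,
      D.coeffAt a b (wsum (fun x => D.weight hw (Rbar q n (i, k) x))
          (fun x => D.left (L x.1 j) * D.right (M x.2 l))) =
        rttLeft q n w (fun i j => seriesCoeff ε₁ fun m => PowerSeries.coeff m (L i j))
          (fun i j => seriesCoeff ε₂ fun m => PowerSeries.coeff m (M i j)) i j k l a b ∧
      D.coeffAt a b (wsum (fun x => D.weight hw' (Rbar q n x (j, l)))
          (fun x => D.right (M k x.2) * D.left (L i x.1))) =
        rttRight q n w' (fun i j => seriesCoeff ε₁ fun m => PowerSeries.coeff m (L i j))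
          (fun i j => seriesCoeff ε₂ fun m => PowerSeries.coeff m (M i j)) i j k l a b := by
    intro i j k l a b
    rw [coeffAt_wsum_left, coeffAt_wsum_right]
    simp only [Fintype.sum_prod_type, rttLeft, rttRight, and_self]
  constructor
  · intro h i k j l
    refine D.ext fun a b => ?_
    rw [(key i j k l a b).1, (key i j k l a b).2, h]
  · intro h i j k l a b
    rw [← (key i j k l a b).1, ← (key i j k l a b).2, h]

/-- The Schur complement of a matrix of power series with respect to its first entry. -/
def serSchur {n : ℕ} (L : Fin (2 * (n + 1)) → Fin (2 * (n + 1)) → B⟦X⟧)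
    (i j : Fin (2 * n)) : B⟦X⟧ :=
  schur L (Ring.inverse (L (first n) (first n))) (shift i) (shift j)

/-- Schur complements with respect to the first entries satisfy the exchange relations of the
smaller rank. -/
theorem rtt_schur {q : K} (hq : q ≠ 0) (D : Expansion B ε₁ ε₂) (n : ℕ) {w w' : B}
    (hw : ∀ x, Commute w x)
    (hw' : ∀ x, Commute w' x) (L M : Fin (2 * (n + 1)) → Fin (2 * (n + 1)) → B⟦X⟧)
    (hL : IsUnit (L (first n) (first n))) (hM : IsUnit (M (first n) (first n)))
    (h : ∀ i j k l a b,
      rttLeft q (n + 1) w (fun i j => seriesCoeff ε₁ fun m => PowerSeries.coeff m (L i j))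
          (fun i j => seriesCoeff ε₂ fun m => PowerSeries.coeff m (M i j)) i j k l a b =
        rttRight q (n + 1) w' (fun i j => seriesCoeff ε₁ fun m => PowerSeries.coeff m (L i j))
          (fun i j => seriesCoeff ε₂ fun m => PowerSeries.coeff m (M i j)) i j k l a b)
    (i j k l : Fin (2 * n)) (a b : ℤ) :
    rttLeft q n w (fun i j => seriesCoeff ε₁ fun m => PowerSeries.coeff m (serSchur L i j))
        (fun i j => seriesCoeff ε₂ fun m => PowerSeries.coeff m (serSchur M i j)) i j k l a b =
      rttRight q n w' (fun i j => seriesCoeff ε₁ fun m => PowerSeries.coeff m (serSchur L i j))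
        (fun i j => seriesCoeff ε₂ fun m => PowerSeries.coeff m (serSchur M i j))
          i j k l a b := by
  refine (rtt_iff q D n hw hw' (serSchur L) (serSchur M)).2 (fun i k j l => ?_) i j k l a b
  have hR := (reduces_Rbar (n := n) hq).map (D.weight hw)
  -- The weight differs from that of `hR`: here `w'` replaces `w`.
  have hT := ((reduces_Rbar (n := n) hq).map (D.weight hw')).transpose
  have := exchange_schur hR hT
    (L := fun i j => D.left (L i j)) (M := fun i j => D.right (M i j))
    (Li := D.left (Ring.inverse (L (first n) (first n))))
    (Mi := D.right (Ring.inverse (M (first n) (first n))))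
    (by rw [← map_mul, Ring.mul_inverse_cancel _ hL, map_one])
    (by rw [← map_mul, Ring.inverse_mul_cancel _ hL, map_one])
    (by rw [← map_mul, Ring.mul_inverse_cancel _ hM, map_one])
    (by rw [← map_mul, Ring.inverse_mul_cancel _ hM, map_one])
    ((rtt_iff q D (n + 1) hw hw' L M).1 h) i k j l
  simpa only [schur, serSchur, map_sub, map_mul] using this

end Translation

/-! ### The algebra `U(R̄)` -/

section Presentation

variable {K : Type*} [Field K] (q : K) (n : ℕ)

/-- The canonical map from the free algebra. -/
def toU : FreeAlgebra K (Gen n) →ₐ[K] U q n := RingQuot.mkAlgHom K (Rel q n)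

lemma toU_fr (x : Gen n) : toU q n (fr K x) = gen q n x := rfl

lemma toU_surjective : Function.Surjective (toU q n) := RingQuot.mkAlgHom_surjective K (Rel q n)

variable {q n}

lemma toU_rel {x y : FreeAlgebra K (Gen n)} (h : Rel q n x y) : toU q n x = toU q n y :=
  RingQuot.mkAlgHom_rel K h

variable {B : Type*} [Ring B] [Algebra K B]

/-- The universal property of `U(R̄)`. -/
lemma exists_lift (f : FreeAlgebra K (Gen n) →ₐ[K] B) (hf : ∀ x y, Rel q n x y → f x = f y) :
    ∃ φ : U q n →ₐ[K] B, ∀ x, φ (toU q n x) = f x :=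
  ⟨RingQuot.liftAlgHom K ⟨f, fun x y h => hf x y h⟩,
    RingQuot.liftAlgHom_mkAlgHom_apply K f fun x y h => hf x y h⟩

lemma U_hom_ext {φ ψ : U q n →ₐ[K] B} (h : ∀ x, φ (gen q n x) = ψ (gen q n x)) : φ = ψ := by
  have : φ.comp (toU q n) = ψ.comp (toU q n) := FreeAlgebra.hom_ext (funext h)
  ext x
  obtain ⟨y, rfl⟩ := toU_surjective q n x
  exact DFunLike.congr_fun this y

lemma commute_of_commute_gen {z : U q n} (h : ∀ x, Commute z (gen q n x)) (y : U q n) :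
    Commute z y := by
  obtain ⟨y, rfl⟩ := toU_surjective q n y
  induction y using FreeAlgebra.induction with
  | grade0 r => rw [AlgHom.commutes]; exact Algebra.commutes' r z |>.symm
  | grade1 x => exact h x
  | mul a b ha hb => rw [map_mul]; exact ha.mul_right hb
  | add a b ha hb => rw [map_add]; exact ha.add_right hb

lemma qc_mul_qcInv : gen q n Gen.qc * gen q n Gen.qcInv = 1 := by
  simpa only [map_mul, map_one, toU_fr] using toU_rel (q := q) (n := n) Rel.qc_mul_inv

lemma qcInv_mul_qc : gen q n Gen.qcInv * gen q n Gen.qc = 1 := by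
  simpa only [map_mul, map_one, toU_fr] using toU_rel (q := q) (n := n) Rel.qc_inv_mul

lemma qc_central (y : U q n) : Commute (gen q n Gen.qc) y :=
  commute_of_commute_gen (fun x => by
    simpa only [map_mul, toU_fr, commute_iff_eq] using toU_rel (q := q) (Rel.qc_central x)) y

lemma qcInv_central (y : U q n) : Commute (gen q n Gen.qcInv) y := by
  let v : (U q n)ˣ := ⟨_, _, qc_mul_qcInv, qcInv_mul_qc⟩
  exact (show Commute (v : U q n) y from qc_central y).units_inv_left

lemma gen_plus_upper {i j : Fin (2 * n)} (h : i < j) : gen q n (Gen.ell true i j 0) = 0 := by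
  simpa only [map_zero, toU_fr] using toU_rel (q := q) (Rel.plus_upper i j h)

lemma gen_minus_lower {i j : Fin (2 * n)} (h : i < j) : gen q n (Gen.ell false j i 0) = 0 := by
  simpa only [map_zero, toU_fr] using toU_rel (q := q) (Rel.minus_lower i j h)

lemma gen_middle (i j : Fin (2 * n)) (hi : (i : ℕ) + 1 = n) (hj : (j : ℕ) = n) :
    gen q n (Gen.ell true i i 0) * gen q n (Gen.ell true j j 0) = 1 := by
  simpa only [map_mul, map_one, toU_fr] using toU_rel (q := q) (Rel.middle i j hi hj)

lemma gen_plus_minus (i : Fin (2 * n)) :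
    gen q n (Gen.ell true i i 0) * gen q n (Gen.ell false i i 0) = 1 := by
  simpa only [map_mul, map_one, toU_fr] using toU_rel (q := q) (Rel.plus_minus i)

lemma gen_minus_plus (i : Fin (2 * n)) :
    gen q n (Gen.ell false i i 0) * gen q n (Gen.ell true i i 0) = 1 := by
  simpa only [map_mul, map_one, toU_fr] using toU_rel (q := q) (Rel.minus_plus i)

lemma map_frL (f : FreeAlgebra K (Gen n) →ₐ[K] B) (ε : Bool) (i j : Fin (2 * n)) (m : ℤ)
    (s : B⟦X⟧) (hs : ∀ k, f (fr K (Gen.ell ε i j k)) = PowerSeries.coeff k s) :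
    f (frL K ε i j m) = seriesCoeff ε (fun k => PowerSeries.coeff k s) m := by
  simp only [frL, seriesCoeff]
  cases ε <;> dsimp only <;> split_ifs <;> simp [hs]

section MapRTT

variable {A : Type*} [Ring A] [Algebra K A] (f : A →ₐ[K] B)
  {w : A} {L M : Fin (2 * n) → Fin (2 * n) → ℤ → A} {w' : B}
  {L' M' : Fin (2 * n) → Fin (2 * n) → ℤ → B}

lemma map_rttLeft (hw : f w = w') (hL : ∀ i j m, f (L i j m) = L' i j m)
    (hM : ∀ i j m, f (M i j m) = M' i j m) (i j k l : Fin (2 * n)) (a b : ℤ) :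
    f (rttLeft q n w L M i j k l a b) = rttLeft q n w' L' M' i j k l a b := by
  simp only [rttLeft, map_sum, map_smul, map_mul, map_pow, hw, hL, hM]

lemma map_rttRight (hw : f w = w') (hL : ∀ i j m, f (L i j m) = L' i j m)
    (hM : ∀ i j m, f (M i j m) = M' i j m) (i j k l : Fin (2 * n)) (a b : ℤ) :
    f (rttRight q n w L M i j k l a b) = rttRight q n w' L' M' i j k l a b := by
  simp only [rttRight, map_sum, map_smul, map_mul, map_pow, hw, hL, hM]

end MapRTT

lemma toU_frL (ε : Bool) (i j : Fin (2 * n)) (m : ℤ) : toU q n (frL K ε i j m) =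
    seriesCoeff ε (fun k => PowerSeries.coeff k (ellSeries q n ε i j)) m :=
  map_frL _ _ _ _ _ _ fun k => by rw [ellSeries, PowerSeries.coeff_mk, toU_fr]

lemma ellSeries_rtt_same (ε : Bool) (i j k l : Fin (2 * n)) (a b : ℤ) :
    rttLeft q n 1
        (fun i j => seriesCoeff ε fun m => PowerSeries.coeff m (ellSeries q n ε i j))
        (fun i j => seriesCoeff ε fun m => PowerSeries.coeff m (ellSeries q n ε i j)) i j k l a b =
      rttRight q n 1
        (fun i j => seriesCoeff ε fun m => PowerSeries.coeff m (ellSeries q n ε i j))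
        (fun i j => seriesCoeff ε fun m => PowerSeries.coeff m (ellSeries q n ε i j))
          i j k l a b := by
  rw [← map_rttLeft (toU q n) (map_one _) (toU_frL ε) (toU_frL ε),
    ← map_rttRight (toU q n) (map_one _) (toU_frL ε) (toU_frL ε)]
  exact toU_rel (Rel.rtt_same ε i j k l a b)

lemma ellSeries_rtt_mixed (i j k l : Fin (2 * n)) (a b : ℤ) :
    rttLeft q n (gen q n Gen.qc ^ 2)
        (fun i j => seriesCoeff true fun m => PowerSeries.coeff m (ellSeries q n true i j))
        (fun i j => seriesCoeff false fun m => PowerSeries.coeff m (ellSeries q n false i j))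
          i j k l a b =
      rttRight q n (gen q n Gen.qcInv ^ 2)
        (fun i j => seriesCoeff true fun m => PowerSeries.coeff m (ellSeries q n true i j))
        (fun i j => seriesCoeff false fun m => PowerSeries.coeff m (ellSeries q n false i j))
          i j k l a b := by
  rw [← toU_fr, ← toU_fr, ← map_rttLeft (toU q n) (map_pow _ (fr K Gen.qc) 2) (toU_frL true) (toU_frL false),
    ← map_rttRight (toU q n) (map_pow _ (fr K Gen.qcInv) 2) (toU_frL true) (toU_frL false)]
  exact toU_rel (Rel.rtt_mixed i j k l a b)

end Presentation

/-! ### The homomorphism between algebras of consecutive ranks -/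

section Homomorphism

variable {K : Type*} [Field K] {q : K} {n : ℕ}

lemma isUnit_ellSeries (ε : Bool) (i : Fin (2 * n)) : IsUnit (ellSeries q n ε i i) := by
  rw [PowerSeries.isUnit_iff_constantCoeff, ← PowerSeries.coeff_zero_eq_constantCoeff_apply,
    ellSeries, PowerSeries.coeff_mk]
  cases ε
  · exact ⟨⟨_, _, gen_minus_plus i, gen_plus_minus i⟩, rfl⟩
  · exact ⟨⟨_, _, gen_plus_minus i, gen_minus_plus i⟩, rfl⟩

/-- At zero modes the correction has the factor `ℓ⁺_{1j}[0] = 0` or `ℓ⁻_{i1}[0] = 0`, so the zero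
mode relations follow from those of the larger rank. -/
lemma coeff_zero_serSchur (ε : Bool) (i j : Fin (2 * n)) :
    PowerSeries.coeff 0 (serSchur (ellSeries q (n + 1) ε) i j) =
      gen q (n + 1) (Gen.ell ε (shift i) (shift j) 0) := by
  have h : ∀ i j, PowerSeries.constantCoeff (ellSeries q (n + 1) ε i j) =
      gen q (n + 1) (Gen.ell ε i j 0) := fun i j => by
    rw [← PowerSeries.coeff_zero_eq_constantCoeff_apply, ellSeries, PowerSeries.coeff_mk]
  rw [PowerSeries.coeff_zero_eq_constantCoeff_apply, serSchur, schur]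
  simp only [map_sub, map_mul, h]
  cases ε
  · rw [gen_minus_lower (first_lt_shift i), zero_mul, zero_mul, sub_zero]
  · rw [gen_plus_upper (first_lt_shift j), mul_zero, sub_zero]

/-- The images of the generators of rank `n` in the algebra of rank `n + 1`. -/
def genImage (q : K) (n : ℕ) : Gen n → U q (n + 1)
  | Gen.qc => gen q (n + 1) Gen.qc
  | Gen.qcInv => gen q (n + 1) Gen.qcInv
  | Gen.ell ε i j m => PowerSeries.coeff m (serSchur (ellSeries q (n + 1) ε) i j)

/-- The images of the generators satisfy the defining relations. -/
theorem lift_genImage_rel (hq : q ≠ 0) (x y : FreeAlgebra K (Gen n)) (h : Rel q n x y) :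
    FreeAlgebra.lift K (genImage q n) x = FreeAlgebra.lift K (genImage q n) y := by
  have hgen : ∀ x, FreeAlgebra.lift K (genImage q n) (fr K x) = genImage q n x :=
    FreeAlgebra.lift_ι_apply _
  have hfrL : ∀ ε i j m, FreeAlgebra.lift K (genImage q n) (frL K ε i j m) =
      seriesCoeff ε (fun k => PowerSeries.coeff k (serSchur (ellSeries q (n + 1) ε) i j)) m :=
    fun ε i j m => map_frL _ _ _ _ _ _ fun k => hgen _
  -- The expansion is an argument because the two signs require different changes of variables.
  have hsame : ∀ (ε : Bool) (_ : Expansion (U q (n + 1)) ε ε) i j k l a b,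
      FreeAlgebra.lift K (genImage q n) (rttLeft q n 1 (frL K ε) (frL K ε) i j k l a b) =
        FreeAlgebra.lift K (genImage q n) (rttRight q n 1 (frL K ε) (frL K ε) i j k l a b) := by
    intro ε D i j k l a b
    rw [map_rttLeft _ (map_one _) (hfrL ε) (hfrL ε), map_rttRight _ (map_one _) (hfrL ε) (hfrL ε)]
    exact rtt_schur hq D n Commute.one_left Commute.one_left _ _ (isUnit_ellSeries ε _)
      (isUnit_ellSeries ε _) (ellSeries_rtt_same ε) i j k l a b
  cases h with
  | qc_mul_inv => simpa only [map_mul, map_one, hgen, genImage] using qc_mul_qcInv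
  | qc_inv_mul => simpa only [map_mul, map_one, hgen, genImage] using qcInv_mul_qc
  | qc_central x => rw [map_mul, map_mul, hgen, hgen]; exact qc_central _
  | plus_upper i j h =>
    rw [hgen, map_zero]
    exact (coeff_zero_serSchur _ _ _).trans (gen_plus_upper (shift_lt_shift.2 h))
  | minus_lower i j h =>
    rw [hgen, map_zero]
    exact (coeff_zero_serSchur _ _ _).trans (gen_minus_lower (shift_lt_shift.2 h))
  | middle i j hi hj =>
    simp only [map_mul, map_one, hgen, genImage, coeff_zero_serSchur]
    -- The shift takes the two middle indices to the two middle indices of the larger rank.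
    exact gen_middle _ _ (by simp [shift, hi]) (by simp [shift, hj])
  | plus_minus i =>
    simp only [map_mul, map_one, hgen, genImage, coeff_zero_serSchur]
    exact gen_plus_minus _
  | minus_plus i =>
    simp only [map_mul, map_one, hgen, genImage, coeff_zero_serSchur]
    exact gen_minus_plus _
  | rtt_same ε i j k l a b =>
    cases ε
    · exact hsame false (minusMinus _) i j k l a b
    · exact hsame true (plusPlus _) i j k l a b
  | rtt_mixed i j k l a b =>
    rw [map_rttLeft _ (map_pow _ (fr K Gen.qc) 2) (hfrL true) (hfrL false),
      map_rttRight _ (map_pow _ (fr K Gen.qcInv) 2) (hfrL true) (hfrL false), hgen, hgen]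
    exact rtt_schur hq (plusMinus _) n (fun x => (qc_central x).pow_left 2)
      (fun x => (qcInv_central x).pow_left 2) _ _ (isUnit_ellSeries true _)
      (isUnit_ellSeries false _) ellSeries_rtt_mixed i j k l a b

/-- The homomorphism between algebras of consecutive ranks, for an arbitrary field. -/
theorem existsUnique_hom (hq : q ≠ 0) : ∃! φ : U q n →ₐ[K] U q (n + 1),
    φ (gen q n Gen.qc) = gen q (n + 1) Gen.qc ∧
    φ (gen q n Gen.qcInv) = gen q (n + 1) Gen.qcInv ∧
    ∀ (ε : Bool) (i j : Fin (2 * n)),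
      PowerSeries.map (φ : U q n →+* U q (n + 1)) (ellSeries q n ε i j) =
        quasiDet !![ellSeries q (n + 1) ε (first n) (first n),
            ellSeries q (n + 1) ε (first n) (shift j);
          ellSeries q (n + 1) ε (shift i) (first n),
            ellSeries q (n + 1) ε (shift i) (shift j)] := by
  have hquasi : ∀ ε i j, serSchur (ellSeries q (n + 1) ε) i j =
      quasiDet !![ellSeries q (n + 1) ε (first n) (first n),
          ellSeries q (n + 1) ε (first n) (shift j);
        ellSeries q (n + 1) ε (shift i) (first n),
          ellSeries q (n + 1) ε (shift i) (shift j)] := by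
    intro ε i j
    simp [quasiDet, serSchur, schur]
  simp only [← hquasi]
  obtain ⟨φ, hφ⟩ := exists_lift (q := q) (FreeAlgebra.lift K (genImage q n))
    (lift_genImage_rel hq)
  have hgen : ∀ x, φ (gen q n x) = genImage q n x := fun x => by
    rw [← toU_fr, hφ, FreeAlgebra.lift_ι_apply]
  refine ⟨φ, ⟨hgen _, hgen _, fun ε i j => ?_⟩, fun ψ hψ => U_hom_ext fun x => ?_⟩
  · ext m
    simp only [PowerSeries.coeff_map, ellSeries, PowerSeries.coeff_mk]
    exact hgen _
  -- Uniqueness: every generator is `q^{±c/2}` or a coefficient of a series with prescribed image.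
  · rw [hgen]
    cases x with
    | qc => exact hψ.1
    | qcInv => exact hψ.2.1
    | ell ε i j m =>
      have := congrArg (PowerSeries.coeff m) (hψ.2.2 ε i j)
      rwa [PowerSeries.coeff_map, ellSeries, PowerSeries.coeff_mk] at this

end Homomorphism

end TwistedRTT

end

/-- For every rank `n + 1 ≥ 2`, over `ℂ(q)`: the series `ℓ^±_{11}(u)` are invertible, and
`q^{±c/2} ↦ q^{±c/2}`, `ℓ^±_{ij}(u) ↦ |ℓ^±_{11}(u), ℓ^±_{1j}(u); ℓ^±_{i1}(u), [ℓ^±_{ij}(u)]|`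
defines a homomorphism of algebras from the algebra of rank `n` to the one of rank `n + 1`. -/
theorem mainTheorem4 (n : ℕ) (hn : 1 ≤ n) :
    (∀ ε : Bool, IsUnit (TwistedRTT.ellSeries (RatFunc.X : RatFunc ℂ) (n + 1) ε
      (TwistedRTT.first n) (TwistedRTT.first n))) ∧
    ∃! φ : TwistedRTT.U (RatFunc.X : RatFunc ℂ) n →ₐ[RatFunc ℂ]
        TwistedRTT.U (RatFunc.X : RatFunc ℂ) (n + 1),
      φ (TwistedRTT.gen RatFunc.X n TwistedRTT.Gen.qc) =
        TwistedRTT.gen RatFunc.X (n + 1) TwistedRTT.Gen.qc ∧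
      φ (TwistedRTT.gen RatFunc.X n TwistedRTT.Gen.qcInv) =
        TwistedRTT.gen RatFunc.X (n + 1) TwistedRTT.Gen.qcInv ∧
      ∀ (ε : Bool) (i j : Fin (2 * n)),
        PowerSeries.map (φ : TwistedRTT.U (RatFunc.X : RatFunc ℂ) n →+*
            TwistedRTT.U (RatFunc.X : RatFunc ℂ) (n + 1))
          (TwistedRTT.ellSeries RatFunc.X n ε i j) =
        TwistedRTT.quasiDet
          !![TwistedRTT.ellSeries RatFunc.X (n + 1) ε (TwistedRTT.first n) (TwistedRTT.first n),
              TwistedRTT.ellSeries RatFunc.X (n + 1) ε (TwistedRTT.first n) (TwistedRTT.shift j);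
            TwistedRTT.ellSeries RatFunc.X (n + 1) ε (TwistedRTT.shift i) (TwistedRTT.first n),
              TwistedRTT.ellSeries RatFunc.X (n + 1) ε (TwistedRTT.shift i)
                (TwistedRTT.shift j)] := by
  have hq : (RatFunc.X : RatFunc ℂ) ≠ 0 := RatFunc.X_ne_zero
  exact ⟨fun ε => TwistedRTT.isUnit_ellSeries ε _, TwistedRTT.existsUnique_hom hq⟩
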